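/- Let $\mathbb N=\{1,2,3,\ldots\}$ and $\omega=\{0,1,2,\ldots\}$. All matrices have rational entries, countably many rows and columns, and only finitely many nonzero entries in each row. For a matrix $M$ and a vector $\vec x$ indexed by the columns of $M$, $\mathrm{Im}(M\vec x)$ denotes the set of entries of $M\vec x$. A $u\times v$ matrix $M$ is image partition regular (IPR) if for every finite colouring of $\mathbb N$ there is $\vec x\in\mathbb N^v$ such that all entries of $M\vec x$ are elements of $\mathbb N$ of the same colour. A set $S\subseteq\mathbb N$ is central if it is a member of some idempotent ultrafilter lying in the smallest two-sided ideal of $(\beta\mathbb N,+)$, where $\beta\mathbb N$ is the set of ultrafilters on $\mathbb N$ and $S\in p+q$ iff $\{x:\{y:x+y\in S\}\in q\}\in p$. A $u\times v$ matrix $M$ is strongly centrally IPR if for every central set $S$ there is $\vec x\in\mathbb N^v$ such that all entries of $M\vec x$ lie in $S$, the entries of $\vec x$ are distinct, and entries of $M\vec x$ corresponding to distinct rows of $M$ are distinct. A matrix $M$ with column set $u$ image dominates a matrix $N$ with column set $w$ if for every $\vec x\in\mathbb N^u$ there is $\vec y\in\mathbb N^w$ with $\mathrm{Im}(N\vec y)\subseteq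 \mathrm{Im}(M\vec x)$. A DH-matrix is an $\omega\times\omega$ matrix $\mathbf D$ obtained as follows: take any enumeration $\langle B_n\rangle_{n=0}^\infty$ of the finite IPR matrices, where $B_n$ has $v(n)$ columns, and let the rows of $\mathbf D$ be exactly the concatenations $\vec r_0{}^\frown\vec r_1{}^\frown\vec r_2{}^\frown\cdots$ for which there is a finite nonempty set $F\subseteq\omega$ such that $\vec r_n$ is a row of $B_n$ if $n\in F$, and $\vec r_n$ is the zero vector of length $v(n)$ if $n\notin F$. Theorem. There is an $(\omega+\omega)\times\omega$ matrix $C=\begin{pmatrix} I\\ A\end{pmatrix}$, where $I$ is the $\omega\times\omega$ identity matrix and $A$ is an $\omega\times\omega$ matrix, such that all entries of $C$ are in $\{0,1,2\}$, each row of $C$ has only finitely many nonzero entries, each column of $C$ has only finitely many nonzero entries and has sum $3$ or $4$, $C$ is strongly centrally IPR, and $C$ is not image dominated by any DH-matrix $\mathbf D$. -/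

import Mathlib

namespace ImagePR

/-- The vector `A x`, for a matrix `A` over `ℚ` with finitely many nonzero entries in each row and
a vector `x` of positive integers. -/
noncomputable def image {ι κ : Type*} (A : Matrix ι κ ℚ) (x : κ → ℕ+) : ι → ℚ :=
  fun i => ∑ᶠ j, A i j * ((x j : ℕ) : ℚ)

/-- Each row has only finitely many nonzero entries. -/
def RowFinite {ι κ : Type*} (A : Matrix ι κ ℚ) : Prop :=
  ∀ i, {j | A i j ≠ 0}.Finite

/-- `A` is image partition regular: for every finite colouring of the positive integers there is
a vector `x` of positive integers such that all entries of `A x` are positive integers of the same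
colour. -/
def IPR {ι κ : Type*} (A : Matrix ι κ ℚ) : Prop :=
  ∀ (r : ℕ) (χ : ℕ+ → Fin r), ∃ (x : κ → ℕ+) (c : Fin r),
    ∀ i, ∃ n : ℕ+, image A x i = ((n : ℕ) : ℚ) ∧ χ n = c

/-- `A` image dominates `B`: every image of `A` contains an image of `B`. -/
def ImageDominates {ι κ ι' κ' : Type*} (A : Matrix ι κ ℚ) (B : Matrix ι' κ' ℚ) : Prop :=
  ∀ x : κ → ℕ+, ∃ y : κ' → ℕ+, Set.range (image B y) ⊆ Set.range (image A x)

section Central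

/- The addition on ultrafilters with `A ∈ p + q ↔ {x | {y | x + y ∈ A} ∈ q} ∈ p`. -/
attribute [local instance] Ultrafilter.add

/-- Nonempty two-sided ideals of `(βℕ, +)`, where `βℕ` is the space of ultrafilters on the
positive integers. -/
def IsTwoSidedIdeal (I : Set (Ultrafilter ℕ+)) : Prop :=
  I.Nonempty ∧ ∀ p ∈ I, ∀ q : Ultrafilter ℕ+, q + p ∈ I ∧ p + q ∈ I

/-- The smallest two-sided ideal `K(βℕ)`. -/
def smallestIdeal : Set (Ultrafilter ℕ+) :=
  {p | ∀ I : Set (Ultrafilter ℕ+), IsTwoSidedIdeal I → p ∈ I}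

/-- Minimal idempotents of `(βℕ, +)`: the idempotents in the smallest two-sided ideal. -/
def IsMinimalIdempotent (p : Ultrafilter ℕ+) : Prop :=
  p + p = p ∧ p ∈ smallestIdeal

/-- A set of positive integers is central if it belongs to some minimal idempotent. -/
def Central (S : Set ℕ+) : Prop :=
  ∃ p : Ultrafilter ℕ+, IsMinimalIdempotent p ∧ S ∈ p

end Central

/-- `A` is strongly centrally IPR: for every central set `S` there is a vector `x` of positive
integers with all entries of `A x` in `S`, such that the entries of `x` are distinct and entries of
`A x` that correspond to distinct rows of `A` are distinct. -/
def StronglyCentrallyIPR {ι κ : Type*} (A : Matrix ι κ ℚ) : Prop :=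
  ∀ S : Set ℕ+, Central S → ∃ x : κ → ℕ+,
    (∀ i, ∃ n ∈ S, image A x i = ((n : ℕ) : ℚ)) ∧
    Function.Injective x ∧
    ∀ i i', A i ≠ A i' → image A x i ≠ image A x i'

/-- A finite matrix over `ℚ` with a positive number of rows and a positive number of columns. -/
structure FinMatrix where
  rows : ℕ+
  cols : ℕ+
  mat : Matrix (Fin rows) (Fin cols) ℚ

/-- `B` lists all the finite IPR matrices over `ℚ`, and nothing else. Repetitions are allowed. -/
def EnumeratesFiniteIPR (B : ℕ → FinMatrix) : Prop :=
  Set.range B = {M : FinMatrix | IPR M.mat}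

/-- The first column of the `n`-th block: the total number of columns of the previous matrices. -/
def blockStart (B : ℕ → FinMatrix) (n : ℕ) : ℕ :=
  ∑ i ∈ Finset.range n, ((B i).cols : ℕ)

/-- `r` is a concatenation `r₀ ⌢ r₁ ⌢ r₂ ⌢ ⋯` where `rₙ` is a row of `B n` for the `n` in some finite
nonempty set `F` and is a zero vector of the length of the rows of `B n` for all other `n`. -/
def IsBlockRow (B : ℕ → FinMatrix) (r : ℕ → ℚ) : Prop :=
  ∃ (F : Finset ℕ) (ρ : ∀ n, Fin (B n).rows), F.Nonempty ∧
    ∀ (n : ℕ) (t : Fin (B n).cols),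
      r (blockStart B n + t) = if n ∈ F then (B n).mat (ρ n) t else 0

/-- `D` is a DH-matrix: for some enumeration `B` of the finite IPR matrices, the rows of `D` are
exactly the block rows built from `B`, in some order. -/
def IsDHMatrix (D : Matrix ℕ ℕ ℚ) : Prop :=
  ∃ B : ℕ → FinMatrix, EnumeratesFiniteIPR B ∧ Set.range (fun i => D i) = {r | IsBlockRow B r}

end ImagePR

/-! The lower rows are `2 xₙ + ∑ xᵢ` with `i` in the window `[2 ^ n, 2 ^ (n + 1))`. The windows
partition the positive integers, which gives the column sums.

Centrality. Let `S` belong to a minimal idempotent `p`. Finitely many rows can be solved in `S`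
because an ultrafilter on sequences can be built coordinate by coordinate so that `x j + ψ x` has
distribution `p` for every additive `ψ` in the earlier coordinates
(`IsMinimalIdempotent.exists_tower`); the last variable of a window plays the role of `x j`. Such a
finite solution need not extend a prescribed one. Extension with `xₙ` already fixed uses the length
of the window instead: a return-time argument yields a row with too many copies of `2 xₙ`, and the
surplus is absorbed by adding `xₙ` to some of the other variables
(`IsMinimalIdempotent.exists_long_row`). This works once the window is long compared with a constant
depending only on the target set, so a finite solution for the initial rows extends forever.

No domination. A finite IPR matrix has an image in which an entry at least twice as large as another
is less divisible by 2 (`IPR.exists_nested_image`): monochromatic images for a logarithmic colouring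
give a grading of the rows, Farkas' lemma makes it exact, and the graded vectors are combined with
coefficients of increasing size and decreasing 2-adic valuation. Scale such images by a rapidly
growing divisibility chain, so that the entries of the DH-image have digits
(`exists_scaling_without_solution`). In a fixed digit `t`, sufficiently many rows hold without
carrying. If `xₙ` has a nonzero digit there, the row value has a digit at least twice as large,
hence less divisible by 2, so some variable in the window must have a less divisible digit as well.
Iterating from `x₀` lowers the valuation more often than the size of the digits allows. -/

namespace ImagePR

/-! ### Minimal idempotents in `(βℕ, +)` -/

section UltrafilterAddition

open Filter

attribute [local instance] Ultrafilter.add Ultrafilter.addSemigroup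

theorem ultrafilter_map_add {M N : Type*} [Add M] [Add N] (f : M → N)
    (hf : ∀ a b, f (a + b) = f a + f b) (p q : Ultrafilter M) :
    (p + q).map f = p.map f + q.map f := by
  ext s
  change (∀ᶠ a in p, ∀ᶠ b in q, f (a + b) ∈ s) ↔ (∀ᶠ a in p, ∀ᶠ b in q, f a + f b ∈ s)
  simp only [hf]

theorem mem_add_iff {M : Type*} [Add M] (p q : Ultrafilter M) (s : Set M) :
    s ∈ p + q ↔ {a | {b | a + b ∈ s} ∈ q} ∈ p := Iff.rfl

theorem continuous_ultrafilter_map {M N : Type*} (f : M → N) :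
    Continuous (fun p : Ultrafilter M => p.map f) :=
  ultrafilterBasis_is_basis.continuous_iff.2 <| Set.forall_mem_range.mpr fun s =>
    ultrafilter_isOpen_basic (f ⁻¹' s)

/-- There is a minimal closed left ideal; it is generated by each of its elements. -/
theorem exists_minimal_leftIdeal (M : Type*) [AddSemigroup M] [Nonempty M] :
    ∃ L : Set (Ultrafilter M), L.Nonempty ∧ (∀ s, ∀ l ∈ L, s + l ∈ L) ∧
      ∀ l ∈ L, ∀ l' ∈ L, ∃ s, l' = s + l := by
  let S : Set (Set (Ultrafilter M)) :=
    {N | IsClosed N ∧ N.Nonempty ∧ ∀ s, ∀ l ∈ N, s + l ∈ N}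
  obtain ⟨L, hL⟩ : ∃ L, Minimal (· ∈ S) L := by
    refine zorn_superset _ fun c hcs hc => ?_
    refine ⟨⋂₀ c, ⟨isClosed_sInter fun t ht => (hcs ht).1, ?_, fun s l hl => ?_⟩, fun s hs =>
      Set.sInter_subset_of_mem hs⟩
    · obtain rfl | hcnemp := c.eq_empty_or_nonempty
      · rw [Set.sInter_empty]
        exact ⟨pure (Classical.arbitrary M), trivial⟩
      have := @IsCompact.nonempty_iInter_of_directed_nonempty_isCompact_isClosed _ _ _
        hcnemp.coe_sort ((↑) : c → Set (Ultrafilter M)) ?_ ?_ ?_ ?_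
      · rwa [Set.sInter_eq_iInter]
      · refine DirectedOn.directed_val (IsChain.directedOn hc.symm)
      exacts [fun i => (hcs i.prop).2.1, fun i => (hcs i.prop).1.isCompact,
        fun i => (hcs i.prop).1]
    · rw [Set.mem_sInter]
      exact fun t ht => (hcs ht).2.2 s l (Set.mem_sInter.mp hl t ht)
  refine ⟨L, hL.prop.2.1, hL.prop.2.2, fun l hl l' hl' => ?_⟩
  -- The left ideal generated by `l` is a continuous image of a compact space, hence closed, so
  -- minimality of `L` applies to it.
  have h : Set.range (· + l) = L := by
    apply hL.eq_of_subset
    · refine ⟨(isCompact_range (Ultrafilter.continuous_add_left l)).isClosed, ⟨_, ⟨l, rfl⟩⟩, ?_⟩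
      rintro s _ ⟨t, rfl⟩
      exact ⟨s + t, add_assoc _ _ _⟩
    · rintro _ ⟨t, rfl⟩
      exact hL.prop.2.2 t l hl
  rw [← h] at hl'
  obtain ⟨s, hs⟩ := hl'
  exact ⟨s, hs.symm⟩

/-- The sums `l + q` with `l` in a minimal left ideal `L` form a two-sided ideal, so `p` is one of
them; left translation of `l` can be undone inside `L`. -/
theorem exists_add_add_eq_of_mem_smallestIdeal {p : Ultrafilter ℕ+} (hp : p ∈ smallestIdeal)
    (q : Ultrafilter ℕ+) : ∃ r, p = r + (q + p) := by
  obtain ⟨L, ⟨l₀, hl₀⟩, hL, hmin⟩ := exists_minimal_leftIdeal ℕ+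
  obtain ⟨l, hl, q', rfl⟩ := hp {u | ∃ l ∈ L, ∃ q, u = l + q} ⟨⟨_, l₀, hl₀, l₀, rfl⟩, by
    rintro _ ⟨l, hl, q, rfl⟩ s
    exact ⟨⟨s + l, hL s l hl, q, (add_assoc s l q).symm⟩, ⟨l, hl, q + s, add_assoc l q s⟩⟩⟩
  obtain ⟨r, hr⟩ := hmin (q + l) (hL q l hl) l hl
  refine ⟨r, ?_⟩
  conv_lhs => rw [hr]
  rw [add_assoc, add_assoc]

/-- Minimality for the order on idempotents: undoing the translation by `f` shows `p = r + f`, so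
`f` is also a right identity for `p`. -/
theorem IsMinimalIdempotent.eq_of_le {p f : Ultrafilter ℕ+} (hp : IsMinimalIdempotent p)
    (hf : f + f = f) (hpf : p + f = f) (hfp : f + p = f) : f = p := by
  obtain ⟨r, hr⟩ := exists_add_add_eq_of_mem_smallestIdeal hp.2 f
  rw [hfp] at hr
  have : p + f = p := by
    conv_lhs => rw [hr]
    rw [add_assoc, hf, ← hr]
  rw [← hpf, this]

theorem IsMinimalIdempotent.Ioi_mem {p : Ultrafilter ℕ+} (hp : IsMinimalIdempotent p) (b : ℕ+) :
    Set.Ioi b ∈ p := by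
  by_contra h
  have h' : Set.Iic b ∈ p := by
    rw [← Set.compl_Ioi]
    exact Ultrafilter.compl_mem_iff_notMem.2 h
  obtain ⟨a, -, ha⟩ := Ultrafilter.eq_pure_of_finite_mem (Set.finite_Iic b) h'
  have h2 := hp.1
  have h1 : {a} ∈ p := by rw [ha]; exact rfl
  rw [← h2, mem_add_iff] at h1
  obtain ⟨x, hx⟩ := p.nonempty_of_mem (Filter.inter_mem h1 (show {a} ∈ p by rw [ha]; exact rfl))
  obtain ⟨y, hy⟩ := p.nonempty_of_mem (Filter.inter_mem hx.1 (show {a} ∈ p by rw [ha]; exact rfl))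
  have e1 : x = a := hx.2
  have e2 : y = a := hy.2
  have e3 : x + y = a := hy.1
  subst e1
  rw [e2] at e3
  have := congrArg PNat.val e3
  simp only [PNat.add_coe] at this
  have := x.pos
  omega

/-- Among sufficiently many positive integers, two have a difference that occurs arbitrarily far
out as a difference of elements of `T`. -/
theorem IsMinimalIdempotent.exists_recurrent_difference {p : Ultrafilter ℕ+}
    (hp : IsMinimalIdempotent p) {T : Set ℕ+} (hT : T ∈ p) :
    ∃ r : ℕ, ∀ A : ℕ → ℕ+, ∃ l i, l < i ∧ i ≤ r ∧
      ∀ b : ℕ+, ∃ y ∈ T, b < y ∧ ∃ z ∈ T, z + A l = y + A i := by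
  -- The set of `x` with `{y | x + y ∈ T} ∈ p` is syndetic. Otherwise some `q` avoids all its
  -- translates, contradicting `p = r + (q + p)`.
  have key : ∃ G : Finset ℕ+, ∀ x : ℕ+, ∃ g ∈ G, {y | g + x + y ∈ T} ∈ p := by
    by_contra! h
    obtain ⟨q, hq⟩ : ∃ q : Ultrafilter ℕ+, ∀ g : ℕ+, {x | {y | g + x + y ∈ T} ∉ p} ∈ q := by
      have hfin : ∀ s : Finset ℕ+, ∃ x : ℕ+, ∀ g ∈ s, {y | g + x + y ∈ T} ∉ p := h
      choose x hx using hfin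
      refine ⟨Ultrafilter.of (Filter.map x atTop), fun g => ?_⟩
      apply Ultrafilter.of_le
      rw [Filter.mem_map, Filter.mem_atTop_sets]
      exact ⟨{g}, fun s hs => hx s g (hs (Finset.mem_singleton_self g))⟩
    obtain ⟨r, hr⟩ := exists_add_add_eq_of_mem_smallestIdeal hp.2 q
    have h1 := hT
    rw [hr, mem_add_iff] at h1
    obtain ⟨g, hg⟩ := r.nonempty_of_mem h1
    have hg' : {x | {y | g + (x + y) ∈ T} ∈ p} ∈ q := hg
    obtain ⟨x, hx1, hx2⟩ := q.nonempty_of_mem (Filter.inter_mem hg' (hq g))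
    simp only [← add_assoc, Set.mem_ofPred_eq] at hx1 hx2
    exact hx2 hx1
  obtain ⟨G, hG⟩ := key
  refine ⟨G.card, fun A => ?_⟩
  choose g hgG hg using fun i => hG (A i)
  obtain ⟨i, hi, j, hj, hij, hgij⟩ := Finset.exists_ne_map_eq_of_card_lt_of_maps_to
    (s := Finset.range (G.card + 1)) (t := G) (f := g) (by simp) (fun i _ => hgG i)
  -- If `A l` and `A i` share the shift `g`, then `g + A l + w` and `g + A i + w` lie in `T` for a
  -- common large `w`.
  have main : ∀ l i, g l = g i → ∀ b : ℕ+, ∃ y ∈ T, b < y ∧ ∃ z ∈ T, z + A l = y + A i := by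
    intro l i hli b
    obtain ⟨y, ⟨hy1, hy2⟩, hy3⟩ := p.nonempty_of_mem
      (Filter.inter_mem (Filter.inter_mem (hg l) (hg i)) (hp.Ioi_mem b))
    simp only [Set.mem_ofPred_eq, Set.mem_Ioi] at hy1 hy2 hy3
    refine ⟨_, hy1, ?_, _, hy2, ?_⟩
    · rw [← PNat.coe_lt_coe] at *
      simp only [PNat.add_coe]
      omega
    · rw [hli]; ac_rfl
  rw [Finset.mem_range] at hi hj
  rcases lt_or_gt_of_ne hij with h | h
  · exact ⟨i, j, h, by omega, main i j hgij⟩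
  · exact ⟨j, i, h, by omega, main j i hgij.symm⟩

/-- A minimal idempotent `p` and an idempotent `q` on a monoid `W` are joined by an idempotent
on `ℕ+ × W` that every map `(a, x) ↦ a + ψ x` sends to `p`. -/
theorem IsMinimalIdempotent.exists_joint {p : Ultrafilter ℕ+} (hp : IsMinimalIdempotent p)
    {W : Type*} [AddMonoid W] {q : Ultrafilter W} (hq : q + q = q) (f : W →+ ℕ) :
    ∃ r : Ultrafilter (ℕ+ × W), r + r = r ∧ r.map Prod.snd = q ∧
      {ax : ℕ+ × W | f ax.2 < ax.1} ∈ r ∧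
      ∀ ψ : W →+ ℕ, r.map (fun ax : ℕ+ × W => (ax.1 : ℕ) + ψ ax.2) = p.map PNat.val := by
  let D : Set (ℕ+ × W) := {ax | f ax.2 < ax.1}
  have hDadd : ∀ r s : Ultrafilter (ℕ+ × W), D ∈ r → D ∈ s → D ∈ r + s := by
    intro r s hr hs
    rw [mem_add_iff]
    filter_upwards [hr] with a ha
    filter_upwards [hs] with b hb
    have ha' : f a.2 < a.1 := ha
    have hb' : f b.2 < b.1 := hb
    change f (a.2 + b.2) < ((a.1 + b.1 : ℕ+) : ℕ)
    rw [map_add, PNat.add_coe]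
    omega
  have hsnd : ∀ r s : Ultrafilter (ℕ+ × W),
      (r + s).map Prod.snd = r.map Prod.snd + s.map Prod.snd :=
    ultrafilter_map_add _ fun _ _ => rfl
  have h0q : ∀ u : Ultrafilter W, pure 0 + u = u := by
    intro u; ext s
    change (∀ᶠ b in u, 0 + b ∈ s) ↔ s ∈ u
    simp
  have hq0 : ∀ u : Ultrafilter W, u + pure 0 = u := by
    intro u; ext s
    change (∀ᶠ b in u, b + 0 ∈ s) ↔ s ∈ u
    simp
  -- A compact subsemigroup containing both the copy `r₀` of `p` and a lift `i` of `q`.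
  let H : Set (Ultrafilter (ℕ+ × W)) := {r | D ∈ r} ∩ (fun r => r.map Prod.snd) ⁻¹' {pure 0, q}
  have hHc : IsCompact H := by
    refine IsClosed.isCompact ((ultrafilter_isClosed_basic _).inter ?_)
    exact (Set.toFinite _).isClosed.preimage (continuous_ultrafilter_map _)
  have hHadd : ∀ r ∈ H, ∀ s ∈ H, r + s ∈ H := by
    rintro r ⟨hr1, hr2⟩ s ⟨hs1, hs2⟩
    refine ⟨hDadd r s hr1 hs1, ?_⟩
    simp only [Set.mem_preimage, Set.mem_insert_iff, Set.mem_singleton_iff, hsnd] at *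
    rcases hr2 with h | h <;> rcases hs2 with h' | h' <;> rw [h, h'] <;> simp [h0q, hq0, hq]
  let r₀ : Ultrafilter (ℕ+ × W) := p.map fun a => (a, 0)
  have hr₀ : r₀ + r₀ = r₀ := by
    rw [← ultrafilter_map_add (fun a : ℕ+ => (a, (0 : W))) (by simp), hp.1]
  have hr₀snd : r₀.map Prod.snd = pure 0 := by
    ext s
    change (∀ᶠ _ in (p : Filter ℕ+), (0 : W) ∈ s) ↔ (0 : W) ∈ s
    simp
  have hr₀D : D ∈ r₀ := by
    change ∀ᶠ a in p, (a, (0 : W)) ∈ D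
    exact Eventually.of_forall fun a => by simp [D]
  let i : Ultrafilter (ℕ+ × W) := q.map fun x => ((f x).succPNat, x)
  have hisnd : i.map Prod.snd = q := by ext s; exact Iff.rfl
  have hiD : D ∈ i := by
    change ∀ᶠ x in q, ((f x).succPNat, x) ∈ D
    exact Eventually.of_forall fun a => by simp [D]
  have hr₀H : r₀ ∈ H := ⟨hr₀D, Or.inl hr₀snd⟩
  have hiH : i ∈ H := ⟨hiD, Or.inr hisnd⟩
  -- An idempotent in the left ideal `H + (i + r₀)` satisfies `e + r₀ = e`. Hence `r₀ + e` is an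
  -- idempotent below `r₀`, and the summand `i` makes it project to `q`.
  obtain ⟨e, ⟨h, hh, he⟩, hee⟩ := exists_idempotent_in_compact_add_subsemigroup
    (Ultrafilter.continuous_add_left (M := ℕ+ × W)) ((· + (i + r₀)) '' H) ⟨_, r₀, hr₀H, rfl⟩
    (hHc.image (Ultrafilter.continuous_add_left _)) (by
      rintro _ ⟨h, hh, rfl⟩ _ ⟨h', hh', rfl⟩
      refine ⟨h + (i + r₀) + h', hHadd _ (hHadd _ hh _ (hHadd _ hiH _ hr₀H)) _ hh', ?_⟩
      exact add_assoc _ _ _)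
  have he' : h + (i + r₀) = e := he
  have her₀ : e + r₀ = e := by rw [← he', add_assoc, add_assoc, hr₀]
  have hesnd : e.map Prod.snd = q := by
    rw [← he', hsnd, hsnd, hisnd, hr₀snd, hq0]
    rcases hh.2 with h' | h' <;> simp only [Set.mem_singleton_iff] at h' <;> rw [h']
    · exact h0q q
    · exact hq
  have hfi : (r₀ + e) + (r₀ + e) = r₀ + e := by
    rw [add_assoc, ← add_assoc e, her₀, hee]
  refine ⟨r₀ + e, hfi, ?_, ?_, fun ψ => ?_⟩
  · rw [hsnd, hr₀snd, hesnd, h0q]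
  · refine hDadd _ _ hr₀D ?_
    rw [← he']
    exact hDadd _ _ hh.1 (hDadd _ _ hiD hr₀D)
  · let φ : ℕ+ × W → ℕ+ := fun ax => ⟨ax.1 + ψ ax.2, Nat.add_pos_left ax.1.pos _⟩
    have hφ : ∀ a b, φ (a + b) = φ a + φ b := by
      intro a b
      apply PNat.eq
      change ((a.1 + b.1 : ℕ+) : ℕ) + ψ (a.2 + b.2) = (a.1 + ψ a.2) + (b.1 + ψ b.2)
      rw [map_add, PNat.add_coe]
      omega
    have hφ₀ : r₀.map φ = p := by
      ext s
      change (∀ᶠ a in p, φ (a, 0) ∈ s) ↔ s ∈ p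
      have : ∀ a : ℕ+, φ (a, 0) = a := fun a => PNat.eq (by simp [φ])
      simp [this]
    -- Each homomorphism `φ` sends `r₀` to `p`, hence `r₀ + e` to an idempotent below `p`, which is
    -- `p` by minimality.
    have : (r₀ + e).map φ = p := by
      apply hp.eq_of_le
      · rw [← ultrafilter_map_add φ hφ, hfi]
      · conv_lhs => rw [← hφ₀]
        rw [← ultrafilter_map_add φ hφ, ← add_assoc, hr₀]
      · conv_lhs => rw [← hφ₀]
        rw [← ultrafilter_map_add φ hφ, add_assoc, her₀]
    conv_rhs => rw [← this]
    rw [Ultrafilter.map_map]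
    rfl

end UltrafilterAddition

end ImagePR

/-! ### Solving the block system in a central set -/

namespace ImagePR

/-- The value at `x` of the `n`-th row of the lower block:
`2 xₙ + ∑ xᵢ` over `2 ^ n ≤ i < 2 ^ (n + 1)`. -/
def blockForm (x : ℕ → ℕ) (n : ℕ) : ℕ :=
  2 * x n + ∑ i ∈ Finset.Ico (2 ^ n) (2 ^ (n + 1)), x i

section BlockSystem

open Filter

attribute [local instance] Ultrafilter.add Ultrafilter.addSemigroup

/-- The part of an ultrafilter-large set that is stable under large translates. -/
theorem exists_translation_stable {p : Ultrafilter ℕ+} (hp : p + p = p) {S : Set ℕ+}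
    (hS : S ∈ p) : ∃ T ⊆ S, T ∈ p ∧ ∀ x ∈ T, {y | x + y ∈ T} ∈ p := by
  have h : ∀ V : Set ℕ+, V ∈ p → {x | {y | x + y ∈ V} ∈ p} ∈ p := by
    intro V hV
    rwa [← hp, mem_add_iff] at hV
  refine ⟨S ∩ {x | {y | x + y ∈ S} ∈ p}, Set.inter_subset_left, inter_mem hS (h S hS), ?_⟩
  rintro x ⟨-, hx⟩
  filter_upwards [hx, h _ hx] with y hy1 hy2
  refine ⟨hy1, ?_⟩
  filter_upwards [hy2] with w hw
  rw [← add_assoc] at hw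
  exact hw

/-- Induction on the number of controlled coordinates, each new one being supplied by
`exists_joint`. The growth condition later separates the values of the rows. -/
theorem IsMinimalIdempotent.exists_tower {p : Ultrafilter ℕ+} (hp : IsMinimalIdempotent p)
    (m : ℕ) : ∃ q : Ultrafilter (ℕ → ℕ), q + q = q ∧ ∀ j < m,
      {x : ℕ → ℕ | 4 * ∑ i ∈ Finset.range j, x i < x j} ∈ q ∧
      ∀ ψ : (ℕ → ℕ) →+ ℕ, (∀ x y : ℕ → ℕ, (∀ i < j, x i = y i) → ψ x = ψ y) →
        q.map (fun x => x j + ψ x) = p.map PNat.val := by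
  induction m with
  | zero =>
    refine ⟨pure 0, ?_, by simp⟩
    ext s
    change (0 : ℕ → ℕ) + 0 ∈ s ↔ (0 : ℕ → ℕ) ∈ s
    rw [add_zero]
  | succ m ih =>
    obtain ⟨q, hq, hqm⟩ := ih
    let f : (ℕ → ℕ) →+ ℕ :=
      { toFun := fun x => 4 * ∑ i ∈ Finset.range m, x i
        map_zero' := by simp
        map_add' := fun x y => by simp [Finset.sum_add_distrib, mul_add] }
    obtain ⟨r, hr, hrsnd, hrf, hrψ⟩ := hp.exists_joint hq f
    -- The new value is added to the old coordinate `m`, which keeps `τ` additive; the old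
    -- coordinate is then absorbed into `ψ`.
    let τ : ℕ+ × (ℕ → ℕ) → ℕ → ℕ := fun ax => ax.2 + Pi.single m (ax.1 : ℕ)
    have hτlt : ∀ ax, ∀ i < m, τ ax i = ax.2 i := by
      intro ax i hi
      simp [τ, Pi.single_eq_of_ne hi.ne]
    have hτm : ∀ ax, τ ax m = ax.1 + ax.2 m := by
      intro ax
      simp [τ, add_comm]
    have hτsum : ∀ ax, ∀ j ≤ m, ∑ i ∈ Finset.range j, τ ax i = ∑ i ∈ Finset.range j, ax.2 i := by
      intro ax j hj
      exact Finset.sum_congr rfl fun i hi => hτlt ax i ((Finset.mem_range.1 hi).trans_le hj)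
    refine ⟨r.map τ, ?_, fun j hj => ?_⟩
    · rw [← ultrafilter_map_add τ, hr]
      intro a b
      simp only [τ, Prod.fst_add, Prod.snd_add, PNat.add_coe, Pi.single_add]
      exact add_add_add_comm _ _ _ _
    rcases (Nat.lt_succ_iff.1 hj).lt_or_eq with hj | rfl
    · constructor
      · have h := (hqm j hj).1
        rw [← hrsnd] at h
        change {ax | 4 * ∑ i ∈ Finset.range j, τ ax i < τ ax j} ∈ r
        simp only [hτsum _ j hj.le, hτlt _ j hj]
        exact h
      · intro ψ hψ
        rw [← (hqm j hj).2 ψ hψ, ← hrsnd]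
        ext s
        change {ax | τ ax j + ψ (τ ax) ∈ s} ∈ r ↔ {ax : ℕ+ × (ℕ → ℕ) | ax.2 j + ψ ax.2 ∈ s} ∈ r
        have : ∀ ax, ψ (τ ax) = ψ ax.2 := fun ax => hψ _ _ fun i hi => hτlt ax i (hi.trans hj)
        simp only [this, hτlt _ j hj]
    · constructor
      · change {ax | 4 * ∑ i ∈ Finset.range j, τ ax i < τ ax j} ∈ r
        filter_upwards [hrf] with ax hax
        rw [hτsum _ j le_rfl, hτm]
        exact hax.trans_le (Nat.le_add_right _ _)
      · intro ψ hψ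
        rw [← hrψ (Pi.evalAddMonoidHom _ j + ψ)]
        ext s
        change {ax | τ ax j + ψ (τ ax) ∈ s} ∈ r ↔
          {ax : ℕ+ × (ℕ → ℕ) | ax.1 + (ax.2 j + ψ ax.2) ∈ s} ∈ r
        have : ∀ ax, ψ (τ ax) = ψ ax.2 := fun ax => hψ _ _ fun i hi => hτlt ax i hi
        simp only [this, hτm, add_assoc]

/-- `x` solves in `T` the part of the system that involves the first `2 ^ n` variables only, with
all values in the order of the last variable involved. -/
structure IsPartialSolution (T : Set ℕ) (n : ℕ) (x : ℕ → ℕ) : Prop where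
  mem : ∀ j < 2 ^ n, x j ∈ T
  lt : ∀ i j, i < j → j < 2 ^ n → x i < x j
  form_mem : ∀ k < n, blockForm x k ∈ T
  form_lt : ∀ k < n, ∀ j, 2 ^ (k + 1) ≤ j → j < 2 ^ n → blockForm x k < x j

theorem blockForm_congr {x y : ℕ → ℕ} {n : ℕ} (h : ∀ j < 2 ^ (n + 1), x j = y j) :
    blockForm x n = blockForm y n := by
  unfold blockForm
  rw [h n ((Nat.lt_succ_self n).trans Nat.lt_two_pow_self)]
  congr 1
  exact Finset.sum_congr rfl fun i hi => h i (Finset.mem_Ico.1 hi).2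

theorem IsPartialSolution.congr {T : Set ℕ} {n : ℕ} {x y : ℕ → ℕ} (h : IsPartialSolution T n x)
    (hxy : ∀ j < 2 ^ n, x j = y j) : IsPartialSolution T n y := by
  have hf : ∀ k < n, blockForm y k = blockForm x k := fun k hk =>
    blockForm_congr fun j hj => (hxy j (hj.trans_le (Nat.pow_le_pow_right two_pos hk))).symm
  refine ⟨fun j hj => ?_, fun i j hij hj => ?_, fun k hk => ?_, fun k hk j hkj hj => ?_⟩
  · rw [← hxy j hj]; exact h.mem j hj
  · rw [← hxy j hj, ← hxy i (hij.trans hj)]; exact h.lt i j hij hj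
  · rw [hf k hk]; exact h.form_mem k hk
  · rw [hf k hk, ← hxy j hj]; exact h.form_lt k hk j hkj hj

/-- Each required membership is a `q`-large event for the tower ultrafilter `q`, so finitely many
hold at once. A row is `x e + ψ x`, with `e` the last index of its window. -/
theorem IsMinimalIdempotent.exists_isPartialSolution {p : Ultrafilter ℕ+}
    (hp : IsMinimalIdempotent p) {T : Set ℕ+} (hT : T ∈ p) (n : ℕ) :
    ∃ x, IsPartialSolution (PNat.val '' T) n x := by
  obtain ⟨q, -, hq⟩ := hp.exists_tower (2 ^ n)
  have hT' : PNat.val '' T ∈ p.map PNat.val :=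
    Ultrafilter.mem_map.2 (Filter.mem_of_superset hT (Set.subset_preimage_image _ _))
  have h1 : {x : ℕ → ℕ | ∀ j ∈ Finset.range (2 ^ n),
      4 * ∑ i ∈ Finset.range j, x i < x j ∧ x j ∈ PNat.val '' T} ∈ q := by
    refine (Filter.eventually_all_finset _).2 fun j hj => ?_
    have h := hq j (Finset.mem_range.1 hj)
    have h' := h.2 0 (fun _ _ _ => rfl)
    rw [← h'] at hT'
    filter_upwards [h.1, hT'] with x hx hx'
    exact ⟨hx, hx'⟩
  have h2 : {x : ℕ → ℕ | ∀ k ∈ Finset.range n, blockForm x k ∈ PNat.val '' T} ∈ q := by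
    refine (Filter.eventually_all_finset _).2 fun k hk => ?_
    obtain ⟨e, he⟩ : ∃ e, 2 ^ (k + 1) = e + 1 := ⟨2 ^ (k + 1) - 1, by
      have := Nat.one_le_two_pow (n := k + 1); omega⟩
    have hke : 2 ^ k ≤ e := by
      have := Nat.one_le_two_pow (n := k)
      rw [pow_succ] at he; omega
    have hk' : k < e := Nat.lt_two_pow_self.trans_le hke
    have hen : e < 2 ^ n := by
      have := Nat.pow_le_pow_right two_pos (Finset.mem_range.1 hk : k + 1 ≤ n)
      omega
    let ψ : (ℕ → ℕ) →+ ℕ :=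
      { toFun := fun x => 2 * x k + ∑ i ∈ Finset.Ico (2 ^ k) e, x i
        map_zero' := by simp
        map_add' := fun x y => by simp only [Pi.add_apply, Finset.sum_add_distrib]; ring }
    have h := (hq e hen).2 ψ (by
      intro x y hxy
      change 2 * x k + ∑ i ∈ Finset.Ico (2 ^ k) e, x i = 2 * y k + ∑ i ∈ Finset.Ico (2 ^ k) e, y i
      rw [hxy k hk', Finset.sum_congr rfl fun i hi => hxy i (Finset.mem_Ico.1 hi).2])
    rw [← h] at hT'
    filter_upwards [hT'] with x hx
    have : blockForm x k = x e + (2 * x k + ∑ i ∈ Finset.Ico (2 ^ k) e, x i) := by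
      unfold blockForm
      rw [he, Finset.sum_Ico_succ_top hke]
      ring
    rw [this]
    exact hx
  obtain ⟨x, hx1, hx2⟩ := q.nonempty_of_mem (Filter.inter_mem h1 h2)
  simp only [Finset.mem_range, Set.mem_ofPred_eq] at hx1 hx2
  refine ⟨x, fun j hj => (hx1 j hj).2, fun i j hij hj => ?_, hx2, fun k hk j hkj hj => ?_⟩
  · have := (hx1 j hj).1
    -- A single term is bounded by the sum; the factor 4 also leaves room for a whole row, which is
    -- at most three times the sum of the earlier variables.
    have := Finset.single_le_sum (f := x) (fun _ _ => Nat.zero_le _) (Finset.mem_range.2 hij)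
    omega
  · have h1 := (hx1 j hj).1
    have h2 := Finset.single_le_sum (f := x) (fun _ _ => Nat.zero_le _)
      (Finset.mem_range.2 (((Nat.lt_succ_self k).trans Nat.lt_two_pow_self).trans_le hkj))
    have h3 : ∑ i ∈ Finset.Ico (2 ^ k) (2 ^ (k + 1)), x i ≤ ∑ i ∈ Finset.range j, x i :=
      Finset.sum_le_sum_of_subset fun i hi =>
        Finset.mem_range.2 ((Finset.mem_Ico.1 hi).2.trans_le hkj)
    unfold blockForm
    omega

theorem sum_truncated_blocks_mem_FS (a : Stream' ℕ) {K l i c : ℕ} (hli : l < i) (hc : c < K) :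
    ∑ j ∈ Finset.Ico l i, ∑ t ∈ Finset.range (c + 1), a.get (j * K + t) ∈ Hindman.FS a := by
  have h : ∀ j, ∑ t ∈ Finset.range (c + 1), a.get (j * K + t)
      = ∑ m ∈ Finset.Ico (j * K) (j * K + (c + 1)), a.get m := by
    intro j
    rw [Finset.sum_Ico_eq_sum_range, Nat.add_sub_cancel_left]
  have hdisj : ∀ j j', j < j' →
      Disjoint (Finset.Ico (j * K) (j * K + (c + 1))) (Finset.Ico (j' * K) (j' * K + (c + 1))) := by
    intro j j' hjj
    rw [Finset.disjoint_left]
    intro m hm hm'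
    rw [Finset.mem_Ico] at hm hm'
    have := Nat.mul_le_mul_right K (Nat.succ_le_of_lt hjj)
    rw [Nat.succ_mul] at this
    omega
  simp only [h]
  rw [← Finset.sum_biUnion]
  · apply Hindman.FS.finsetSum
    exact ⟨l * K, Finset.mem_biUnion.2 ⟨l, Finset.left_mem_Ico.2 hli, Finset.mem_Ico.2 (by omega)⟩⟩
  · intro j _ j' _ hjj
    rcases lt_or_gt_of_ne hjj with h | h
    · exact hdisj j j' h
    · exact (hdisj j' j h).symm

/-- If `T` is translation stable, then all sufficiently long rows `2x + u₀ + ⋯ + u_{K-1} + y` with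
`x ∈ T` given can be solved in `T` by large increasing `u₀ < ⋯ < u_{K-1} < y`. -/
theorem IsMinimalIdempotent.exists_long_row {p : Ultrafilter ℕ+} (hp : IsMinimalIdempotent p)
    {T : Set ℕ+} (hT : T ∈ p) (hTT : ∀ x ∈ T, {y | x + y ∈ T} ∈ p) :
    ∃ r : ℕ, ∀ x ∈ T, ∀ b K : ℕ, 2 * r ≤ K → ∃ (u : ℕ → ℕ) (y : ℕ),
      (∀ c < K, u c ∈ PNat.val '' T ∧ b < u c) ∧ (∀ c, c + 1 < K → u c < u (c + 1)) ∧
      y ∈ PNat.val '' T ∧ b < y ∧ (∀ c < K, u c < y) ∧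
      2 * x + ∑ c ∈ Finset.range K, u c + y ∈ PNat.val '' T := by
  obtain ⟨r, hr⟩ := hp.exists_recurrent_difference hT
  refine ⟨r, fun x hx b K hK => ?_⟩
  -- Elements of `V` stay in `T` with or without an added `x`, and exceed `b + x`.
  let V : Set ℕ+ := T ∩ {y | x + y ∈ T} ∩ Set.Ioi (b.succPNat + x)
  have hV : V ∈ p := inter_mem (inter_mem hT (hTT x hx)) (hp.Ioi_mem _)
  obtain ⟨a, ha⟩ := Hindman.exists_FS_of_large (p.map PNat.val)
    (by rw [← ultrafilter_map_add _ PNat.add_coe, hp.1]) (PNat.val '' V)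
    (Ultrafilter.mem_map.2 (Filter.mem_of_superset hV (Set.subset_preimage_image _ _)))
  have hval : ∀ v ∈ Hindman.FS a,
      v ∈ PNat.val '' T ∧ (x : ℕ) + v ∈ PNat.val '' T ∧ b + x < v := by
    intro v hv
    obtain ⟨w, ⟨⟨hw1, hw2⟩, hw3⟩, rfl⟩ := ha hv
    refine ⟨⟨w, hw1, rfl⟩, ⟨x + w, hw2, rfl⟩, ?_⟩
    have : (b.succPNat + x : ℕ+) < w := hw3
    rw [← PNat.coe_lt_coe, PNat.add_coe, Nat.succPNat_coe] at this
    change b + x < (w : ℕ)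
    omega
  -- A prototype row built from the `j`-th group of `K` generators, its variables being the partial
  -- sums of the group. A return between `l` and `i` superposes the `i - l` prototypes.
  let g : ℕ → ℕ := fun j =>
    2 * x + ∑ c ∈ Finset.range K, ∑ t ∈ Finset.range (c + 1), a.get (j * K + t)
  obtain ⟨l, i, hli, hir, hrec⟩ := hr fun j => (∑ j' ∈ Finset.range j, g j').succPNat
  let E : ℕ → ℕ := fun c =>
    ∑ j ∈ Finset.Ico l i, ∑ t ∈ Finset.range (c + 1), a.get (j * K + t)
  -- The superposition contains `2 (i - l) x` instead of `2 x`. The surplus goes into `2 (i - l - 1)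
  -- ≤ 2 r ≤ K` variables.
  let u : ℕ → ℕ := fun c => E c + if c < 2 * (i - l - 1) then (x : ℕ) else 0
  obtain ⟨y, hy, hby, z, hz, hzy⟩ := hrec (b + ∑ c ∈ Finset.range K, u c).succPNat
  rw [← PNat.coe_lt_coe, Nat.succPNat_coe] at hby
  have hE : ∀ c < K, E c ∈ Hindman.FS a := fun c hc => sum_truncated_blocks_mem_FS a hli hc
  refine ⟨u, y, fun c hc => ?_, fun c hc => ?_, ⟨y, hy, rfl⟩, by omega, fun c hc => ?_,
    ⟨z, hz, ?_⟩⟩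
  · obtain ⟨h1, h2, h3⟩ := hval _ (hE c hc)
    simp only [u]
    split_ifs
    · rw [add_comm (E c)]
      exact ⟨h2, by omega⟩
    · exact ⟨by simpa using h1, by omega⟩
  · have h1 : E (c + 1) = E c + ∑ j ∈ Finset.Ico l i, a.get (j * K + (c + 1)) := by
      simp only [E]
      rw [← Finset.sum_add_distrib]
      exact Finset.sum_congr rfl fun j _ => Finset.sum_range_succ _ _
    have h2 := Finset.single_le_sum (f := fun j => a.get (j * K + (c + 1)))
      (fun _ _ => Nat.zero_le _) (Finset.left_mem_Ico.2 hli)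
    -- Every generator exceeds `x`, so `u` still increases where the added `x` stops.
    have h3 := (hval _ (Hindman.FS.singleton a (l * K + (c + 1)))).2.2
    simp only [u]
    split_ifs <;> omega
  · have := Finset.single_le_sum (f := u) (fun _ _ => Nat.zero_le _) (Finset.mem_range.2 hc)
    omega
  · have h1 : (z : ℕ) + (∑ j' ∈ Finset.range l, g j' + 1)
        = y + (∑ j' ∈ Finset.range i, g j' + 1) := congrArg PNat.val hzy
    have h2 := Finset.sum_range_add_sum_Ico g hli.le
    have h3 : ∑ j ∈ Finset.Ico l i, g j = (i - l) * (2 * x) + ∑ c ∈ Finset.range K, E c := by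
      simp only [g, E]
      rw [Finset.sum_add_distrib, Finset.sum_comm]
      simp
    have h4 : ∑ c ∈ Finset.range K, u c
        = ∑ c ∈ Finset.range K, E c + 2 * (i - l - 1) * x := by
      simp only [u]
      rw [Finset.sum_add_distrib, ← Finset.sum_filter]
      have : (Finset.range K).filter (· < 2 * (i - l - 1)) = Finset.range (2 * (i - l - 1)) := by
        ext c
        simp only [Finset.mem_filter, Finset.mem_range]
        omega
      rw [this]
      simp
    obtain ⟨d, hd⟩ : ∃ d, i - l = d + 1 := ⟨i - l - 1, by omega⟩
    rw [h4]
    rw [hd] at h3 ⊢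
    have h5 : (d + 1) * (2 * (x : ℕ)) = 2 * x + 2 * d * x := by ring
    rw [Nat.add_sub_cancel]
    change (z : ℕ) = _
    omega

/-- The window of row `n` consists exactly of the new variables, so only this row has to be solved;
choosing them above all earlier variables and rows preserves the order. -/
theorem IsPartialSolution.exists_extension {T : Set ℕ} {n : ℕ} {x : ℕ → ℕ}
    (h : IsPartialSolution T n x)
    (hrow : ∀ b : ℕ, ∃ (u : ℕ → ℕ) (y : ℕ),
      (∀ c < 2 ^ n - 1, u c ∈ T ∧ b < u c) ∧ (∀ c, c + 1 < 2 ^ n - 1 → u c < u (c + 1)) ∧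
      y ∈ T ∧ b < y ∧ (∀ c < 2 ^ n - 1, u c < y) ∧
      2 * x n + ∑ c ∈ Finset.range (2 ^ n - 1), u c + y ∈ T) :
    ∃ x', IsPartialSolution T (n + 1) x' ∧ ∀ j < 2 ^ n, x j = x' j := by
  obtain ⟨u, y, hu, hulti, hyT, hby, huy, hform⟩ :=
    hrow (∑ j ∈ Finset.range (2 ^ n), x j + ∑ k ∈ Finset.range n, blockForm x k)
  set b := ∑ j ∈ Finset.range (2 ^ n), x j + ∑ k ∈ Finset.range n, blockForm x k with hb
  have hxb : ∀ j < 2 ^ n, x j ≤ b := fun j hj => by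
    have := Finset.single_le_sum (f := x) (fun _ _ => Nat.zero_le _) (Finset.mem_range.2 hj)
    omega
  have hfb : ∀ k < n, blockForm x k ≤ b := fun k hk => by
    have := Finset.single_le_sum (f := blockForm x) (fun _ _ => Nat.zero_le _)
      (Finset.mem_range.2 hk)
    omega
  let v : ℕ → ℕ := fun c => if c < 2 ^ n - 1 then u c else y
  let x' : ℕ → ℕ := fun j => if j < 2 ^ n then x j else v (j - 2 ^ n)
  have hvT : ∀ c, v c ∈ T := by
    intro c
    simp only [v]
    split_ifs with hc
    exacts [(hu c hc).1, hyT]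
  have hvb : ∀ c, b < v c := by
    intro c
    simp only [v]
    split_ifs with hc
    exacts [(hu c hc).2, hby]
  have hvsucc : ∀ c, c + 1 < 2 ^ n → v c < v (c + 1) := by
    intro c hc
    have h1 : c < 2 ^ n - 1 := by omega
    simp only [v, if_pos h1]
    split_ifs with h2
    exacts [hulti c h2, huy c h1]
  have hvlt : ∀ d c, c + d + 1 < 2 ^ n → v c < v (c + d + 1) := by
    intro d
    induction d with
    | zero => exact fun c hc => hvsucc c hc
    | succ d ih => exact fun c hc => (ih c (by omega)).trans (hvsucc (c + d + 1) hc)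
  have hx' : ∀ j < 2 ^ n, x' j = x j := fun j hj => if_pos hj
  have hx'' : ∀ j, 2 ^ n ≤ j → x' j = v (j - 2 ^ n) := fun j hj => if_neg (by omega)
  have hn : 2 ^ (n + 1) = 2 ^ n + 2 ^ n := by rw [pow_succ]; ring
  have hform' : ∀ k < n, blockForm x' k = blockForm x k := fun k hk =>
    blockForm_congr fun j hj => hx' j (hj.trans_le (Nat.pow_le_pow_right two_pos hk))
  refine ⟨x', ⟨fun j hj => ?_, fun i j hij hj => ?_, fun k hk => ?_, fun k hk j hkj hj => ?_⟩,
    fun j hj => (hx' j hj).symm⟩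
  · rcases lt_or_ge j (2 ^ n) with hj' | hj'
    · rw [hx' j hj']; exact h.mem j hj'
    · rw [hx'' j hj']; exact hvT _
  · rcases lt_or_ge j (2 ^ n) with hj' | hj'
    · rw [hx' j hj', hx' i (hij.trans hj')]; exact h.lt i j hij hj'
    · rw [hx'' j hj']
      rcases lt_or_ge i (2 ^ n) with hi' | hi'
      · rw [hx' i hi']; exact (hxb i hi').trans_lt (hvb _)
      · rw [hx'' i hi']
        have := hvlt (j - i - 1) (i - 2 ^ n) (by omega)
        rwa [show i - 2 ^ n + (j - i - 1) + 1 = j - 2 ^ n by omega] at this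
  · rcases (Nat.lt_succ_iff.1 hk).lt_or_eq with hk | rfl
    · rw [hform' k hk]; exact h.form_mem k hk
    · have h1 : ∑ i ∈ Finset.Ico (2 ^ k) (2 ^ (k + 1)), x' i
          = ∑ c ∈ Finset.range (2 ^ k - 1), u c + y := by
        rw [Finset.sum_Ico_eq_sum_range, show 2 ^ (k + 1) - 2 ^ k = (2 ^ k - 1) + 1 by
          have := Nat.one_le_two_pow (n := k); omega, Finset.sum_range_succ]
        congr 1
        · refine Finset.sum_congr rfl fun c hc => ?_
          rw [hx'' _ (Nat.le_add_right _ _), Nat.add_sub_cancel_left]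
          exact if_pos (Finset.mem_range.1 hc)
        · rw [hx'' _ (Nat.le_add_right _ _), Nat.add_sub_cancel_left]
          exact if_neg (lt_irrefl _)
      unfold blockForm
      rw [h1, hx' k Nat.lt_two_pow_self, ← add_assoc]
      exact hform
  · rcases lt_or_ge j (2 ^ n) with hj' | hj'
    · have hk' : k < n := by
        by_contra hk'
        have := Nat.pow_le_pow_right two_pos (show n ≤ k + 1 by omega)
        omega
      rw [hx' j hj', hform' k hk']
      exact h.form_lt k hk' j hkj hj'
    · have hk' : k < n := by
        by_contra hk'
        have := Nat.pow_le_pow_right two_pos (show n + 1 ≤ k + 1 by omega)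
        omega
      rw [hx'' j hj', hform' k hk']
      exact (hfb k hk').trans_lt (hvb _)

/-- Every central set contains an injective solution of the whole block system. -/
theorem Central.exists_solution {S : Set ℕ+} (hS : Central S) :
    ∃ x : ℕ → ℕ, ∀ n, IsPartialSolution (PNat.val '' S) n x := by
  obtain ⟨p, hp, hSp⟩ := hS
  obtain ⟨T, hTS, hT, hTT⟩ := exists_translation_stable hp.1 hSp
  obtain ⟨r, hr⟩ := hp.exists_long_row hT hTT
  have hext : ∀ n, 2 * r < n → ∀ x, IsPartialSolution (PNat.val '' T) n x →
      ∃ x', IsPartialSolution (PNat.val '' T) (n + 1) x' ∧ ∀ j < 2 ^ n, x j = x' j := by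
    intro n hn x hx
    have h2 : n < 2 ^ n := Nat.lt_two_pow_self
    obtain ⟨w, hw, hwn⟩ := hx.mem n h2
    refine hx.exists_extension fun b => ?_
    have := hr w hw b (2 ^ n - 1) (by omega)
    rwa [show (w : ℕ) = x n from hwn] at this
  set N := 2 * r + 1 with hN
  obtain ⟨x₀, hx₀⟩ := hp.exists_isPartialSolution hT N
  let next : ∀ k, {x // IsPartialSolution (PNat.val '' T) (N + k) x} →
      {x // IsPartialSolution (PNat.val '' T) (N + (k + 1)) x} := fun k x =>
    ⟨(hext (N + k) (by omega) x.1 x.2).choose, (hext (N + k) (by omega) x.1 x.2).choose_spec.1⟩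
  let s : ∀ k, {x // IsPartialSolution (PNat.val '' T) (N + k) x} := fun k =>
    Nat.rec ⟨x₀, hx₀⟩ next k
  have hs : ∀ k, ∀ j < 2 ^ (N + k), (s k).1 j = (s (k + 1)).1 j := fun k =>
    (hext (N + k) (by omega) (s k).1 (s k).2).choose_spec.2
  have hs' : ∀ k d, ∀ j < 2 ^ (N + k), (s k).1 j = (s (k + d)).1 j := by
    intro k d
    induction d with
    | zero => exact fun _ _ => rfl
    | succ d ih =>
      exact fun j hj => (ih j hj).trans (hs (k + d) j
        (hj.trans_le (Nat.pow_le_pow_right two_pos (by omega))))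
  -- Coordinate `j` is already final at stage `j`, since `j < 2 ^ (N + j)`.
  let x : ℕ → ℕ := fun j => (s j).1 j
  have hx : ∀ k, IsPartialSolution (PNat.val '' T) (N + k) x := by
    intro k
    refine (s k).2.congr fun j hj => ?_
    rcases le_total j k with hjk | hjk
    · have := hs' j (k - j) j ((Nat.lt_two_pow_self).trans_le
        (Nat.pow_le_pow_right two_pos (by omega)))
      rw [show j + (k - j) = k by omega] at this
      exact this.symm
    · have := hs' k (j - k) j hj
      rwa [show k + (j - k) = j by omega] at this
  refine ⟨x, fun n => ?_⟩
  have h := hx n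
  have hle : n ≤ N + n := by omega
  have hpow : 2 ^ n ≤ 2 ^ (N + n) := Nat.pow_le_pow_right two_pos hle
  exact ⟨fun j hj => Set.image_mono hTS (h.mem j (hj.trans_le hpow)),
    fun i j hij hj => h.lt i j hij (hj.trans_le hpow),
    fun k hk => Set.image_mono hTS (h.form_mem k (hk.trans_le hle)),
    fun k hk j hkj hj => h.form_lt k (hk.trans_le hle) j hkj (hj.trans_le hpow)⟩

end BlockSystem

end ImagePR

/-! ### Farkas' lemma and the grading of a finite IPR matrix -/

namespace ImagePR

/-- **Farkas' lemma** for finitely many vectors of a rational vector space. -/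
theorem exists_nonneg_combination_or_separating {V : Type*} [AddCommGroup V] [Module ℚ V] (n : ℕ) :
    ∀ (a : Fin n → V) (y : V), (∃ x : Fin n → ℚ, (∀ j, 0 ≤ x j) ∧ ∑ j, x j • a j = y) ∨
      ∃ f : V →ₗ[ℚ] ℚ, (∀ j, 0 ≤ f (a j)) ∧ f y < 0 := by
  induction n with
  | zero =>
    intro a y
    by_cases hy : y = 0
    · exact Or.inl ⟨0, by simp, by simp [hy]⟩
    · right
      obtain ⟨f, hf⟩ : ∃ f : Module.Dual ℚ V, f y ≠ 0 := by
        by_contra! h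
        exact hy ((Module.forall_dual_apply_eq_zero_iff ℚ y).1 h)
      rcases lt_or_gt_of_ne hf with h | h
      · exact ⟨f, fun j => j.elim0, h⟩
      · exact ⟨-f, fun j => j.elim0, by simpa using h⟩
  | succ n ih =>
    intro a y
    rcases ih (fun j => a j.castSucc) y with ⟨x, hx, hxy⟩ | ⟨f, hf, hfy⟩
    · left
      refine ⟨Fin.snoc x 0, fun j => ?_, ?_⟩
      · refine Fin.lastCases ?_ (fun j => ?_) j <;> simp [hx]
      · simp [Fin.sum_univ_castSucc, hxy]
    · set b := a (Fin.last n) with hb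
      by_cases hfb : 0 ≤ f b
      · right
        exact ⟨f, fun j => Fin.lastCases hfb hf j, hfy⟩
      push Not at hfb
      have hne : f b ≠ 0 := hfb.ne
      -- Here `f b < 0`. All vectors are projected along `b` to the kernel of `f`; the signs of `f`
      -- make the recovered coefficient of `b` nonnegative.
      rcases ih (fun j => a j.castSucc - (f (a j.castSucc) / f b) • b) (y - (f y / f b) • b) with
        ⟨x, hx, hxy⟩ | ⟨g, hg, hgy⟩
      · left
        refine ⟨Fin.snoc x (f y / f b - ∑ j, x j * (f (a j.castSucc) / f b)), fun j => ?_, ?_⟩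
        · refine Fin.lastCases ?_ (fun j => ?_) j
          · rw [Fin.snoc_last]
            have h1 : 0 ≤ f y / f b := div_nonneg_of_nonpos hfy.le hfb.le
            have h2 : ∑ j, x j * (f (a j.castSucc) / f b) ≤ 0 :=
              Finset.sum_nonpos fun j _ => mul_nonpos_of_nonneg_of_nonpos (hx j)
                (div_nonpos_of_nonneg_of_nonpos (hf j) hfb.le)
            linarith
          · simp [hx]
        · simp only [Fin.sum_univ_castSucc, Fin.snoc_castSucc, Fin.snoc_last]
          simp only [smul_sub, Finset.sum_sub_distrib, smul_smul, ← Finset.sum_smul] at hxy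
          rw [← hb, sub_smul]
          rw [sub_eq_iff_eq_add] at hxy
          rw [hxy]
          abel
      · right
        refine ⟨g - (g b / f b) • f, fun j => ?_, ?_⟩
        · refine Fin.lastCases ?_ (fun j => ?_) j
          · rw [← hb]
            simp [div_mul_cancel₀ _ hne]
          · have := hg j
            simp only [map_sub, map_smul, smul_eq_mul, LinearMap.sub_apply,
              LinearMap.smul_apply] at this ⊢
            convert this using 1
            ring
        · simp only [map_sub, map_smul, smul_eq_mul, LinearMap.sub_apply,
            LinearMap.smul_apply] at hgy ⊢
          convert hgy using 1
          ring

theorem image_eq_sum {ι κ : Type*} [Fintype κ] (B : Matrix ι κ ℚ) (x : κ → ℕ+) (i : ι) :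
    image B x i = ∑ j, B i j * ((x j : ℕ) : ℚ) :=
  finsum_eq_sum_of_fintype _

/-- A solution of `B x ≈ 𝟙_K` on the rows in `T`, up to any precision, gives an exact one. -/
theorem exists_exact_solution {ι : Type*} [Fintype ι] [DecidableEq ι] {n : ℕ}
    (B : Matrix ι (Fin n) ℚ) (T K : Finset ι) :
    ∃ δ : ℚ, 0 < δ ∧ ∀ (x : Fin n → ℚ) (S : ℚ), 0 < S → (∀ j, 0 ≤ x j) →
      (∀ i ∈ T, |∑ j, B i j * x j - if i ∈ K then S else 0| ≤ δ * S) →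
      ∃ ξ : Fin n → ℚ, (∀ j, 0 ≤ ξ j) ∧
        ∀ i ∈ T, ∑ j, B i j * ξ j = if i ∈ K then 1 else 0 := by
  rcases exists_nonneg_combination_or_separating n
    (fun j => (fun i => if i ∈ T then B i j else 0 : ι → ℚ))
    (fun i => if i ∈ T then (if i ∈ K then 1 else 0) else 0) with ⟨ξ, hξ, h⟩ | ⟨f, hf, hfy⟩
  · refine ⟨1, one_pos, fun x S _ _ _ => ⟨ξ, hξ, fun i hi => ?_⟩⟩
    have := congrFun h i
    simp only [Finset.sum_apply, Pi.smul_apply, smul_eq_mul, if_pos hi] at this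
    rw [← this]
    exact Finset.sum_congr rfl fun j _ => mul_comm _ _
  · set y : ι → ℚ := fun i => if i ∈ T then (if i ∈ K then 1 else 0) else 0 with hy
    set N : ℚ := ∑ i, |f (Pi.single i 1)| with hN
    have hN0 : 0 ≤ N := Finset.sum_nonneg fun i _ => abs_nonneg _
    have hfapply : ∀ v : ι → ℚ, f v = ∑ i, v i * f (Pi.single i 1) := by
      intro v
      conv_lhs => rw [pi_eq_sum_univ' v, map_sum]
      exact Finset.sum_congr rfl fun i _ => map_smul f _ _
    -- With this precision `f` would remain negative on the approximate solution, although it is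
    -- nonnegative on the cone of the columns.
    refine ⟨-f y / (N + 1), div_pos (by linarith) (by linarith), fun x S hS hx hxS => ?_⟩
    exfalso
    set w : ι → ℚ := fun i => if i ∈ T then ∑ j, B i j * x j else 0 with hw
    have h1 : 0 ≤ f w := by
      have : w = ∑ j, x j • (fun i => if i ∈ T then B i j else 0 : ι → ℚ) := by
        ext i
        simp only [hw, Finset.sum_apply, Pi.smul_apply, smul_eq_mul]
        split_ifs
        · exact Finset.sum_congr rfl fun j _ => mul_comm _ _
        · simp
      rw [this, map_sum]
      exact Finset.sum_nonneg fun j _ => by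
        rw [map_smul]
        exact mul_nonneg (hx j) (hf j)
    have h2 : f (w - S • y) ≤ -f y / (N + 1) * S * N := by
      rw [hfapply, hN, Finset.mul_sum]
      refine Finset.sum_le_sum fun i _ => (le_abs_self _).trans ?_
      rw [abs_mul]
      refine mul_le_mul_of_nonneg_right ?_ (abs_nonneg _)
      by_cases hi : i ∈ T
      · have := hxS i hi
        simpa [hw, hy, hi] using this
      · simp only [Pi.sub_apply, Pi.smul_apply, hw, hy, hi, if_false, smul_zero, sub_zero, abs_zero]
        exact mul_nonneg (div_nonneg (by linarith) (by linarith)) hS.le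
    rw [map_sub, map_smul, smul_eq_mul] at h2
    have h3 : -f y / (N + 1) * S * N < S * (-f y) := by
      have : -f y / (N + 1) * S * N = S * (-f y) * (N / (N + 1)) := by field_simp
      rw [this]
      refine mul_lt_of_lt_one_right (mul_pos hS (by linarith)) ?_
      rw [div_lt_one (by linarith)]
      linarith
    linarith

/-- The rows of a finite image partition regular matrix can be graded in such a way that for each
degree there is a nonnegative vector that all rows of this degree send to `1` and all rows of
lower degree send to `0`. -/
theorem IPR.exists_grading {ι : Type*} [Fintype ι] {n : ℕ} {B : Matrix ι (Fin n) ℚ}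
    (hB : IPR B) : ∃ k : ι → ℕ, ∀ l, ∃ ξ : Fin n → ℚ, (∀ j, 0 ≤ ξ j) ∧
      (∀ i, k i = l → ∑ j, B i j * ξ j = 1) ∧ ∀ i, k i < l → ∑ j, B i j * ξ j = 0 := by
  classical
  choose δ hδ hex using fun TK : Finset ι × Finset ι => exists_exact_solution B TK.1 TK.2
  -- The precision must serve all pairs of row sets, because the colouring is fixed before the image
  -- reveals which rows are of comparable size.
  obtain ⟨ε, hε, hεδ⟩ : ∃ ε : ℚ, 0 < ε ∧ ∀ TK, ε ≤ δ TK := by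
    refine ⟨Finset.univ.inf' Finset.univ_nonempty δ, ?_, fun TK =>
      Finset.inf'_le _ (Finset.mem_univ _)⟩
    rw [Finset.lt_inf'_iff]
    exact fun TK _ => hδ TK
  have hb : (1 : ℚ) < 1 + ε := by linarith
  have hpow : ∀ m : ℕ+, ∃ k : ℕ, (1 + ε) ^ k ≤ (m : ℕ) ∧ ((m : ℕ) : ℚ) < (1 + ε) ^ (k + 1) :=
    fun m => exists_nat_pow_near (by exact_mod_cast m.pos) hb
  choose d hd1 hd2 using hpow
  obtain ⟨M, hM⟩ := pow_unbounded_of_one_lt ((1 + ε) / ε) hb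
  rw [div_lt_iff₀ hε] at hM
  -- Logarithms to base `1 + ε` are coloured modulo `M + 1`. Entries of one colour agree up to the
  -- factor `1 + ε` or differ so much that the smaller is at most `ε` times the scale of the larger.
  obtain ⟨x, c, hxc⟩ := hB (M + 1) fun m => ⟨d m % (M + 1), Nat.mod_lt _ M.succ_pos⟩
  choose w hw hwc using hxc
  refine ⟨fun i => d (w i), fun l => ?_⟩
  by_cases hl : ∃ i₀, d (w i₀) = l
  swap
  · exact ⟨0, fun _ => le_rfl, fun i hi => (hl ⟨i, hi⟩).elim, fun i _ => by simp⟩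
  obtain ⟨i₀, hi₀⟩ := hl
  obtain ⟨ξ, hξ, h⟩ := hex (Finset.univ.filter fun i => d (w i) ≤ l,
      Finset.univ.filter fun i => d (w i) = l) (fun j => ((x j : ℕ) : ℚ)) ((1 + ε) ^ l)
      (by positivity) (fun j => by positivity) (by
    intro i hi
    rw [Finset.mem_filter] at hi
    rw [← image_eq_sum, hw]
    refine le_trans ?_ (mul_le_mul_of_nonneg_right (hεδ _) (by positivity))
    have h1 := hd1 (w i)
    have h2 := hd2 (w i)
    by_cases hil : d (w i) = l
    · rw [if_pos (by simpa using hil)]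
      rw [hil] at h1 h2
      rw [pow_succ] at h2
      rw [abs_le]
      constructor
      · have : 0 ≤ ε * (1 + ε) ^ l := by positivity
        linarith
      · linarith
    · rw [if_neg (by simpa using hil), sub_zero, abs_of_nonneg (by positivity)]
      have hmod : d (w i) ≡ d (w i₀) [MOD M + 1] := by
        have := (hwc i).trans (hwc i₀).symm
        exact Fin.mk.inj_iff.1 this
      have hlt : d (w i) < l := lt_of_le_of_ne hi.2 hil
      rw [hi₀] at hmod
      have hdvd : M + 1 ∣ l - d (w i) := (Nat.modEq_iff_dvd' hlt.le).1 hmod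
      have hle : M + 1 ≤ l - d (w i) := Nat.le_of_dvd (by omega) hdvd
      obtain ⟨e, rfl⟩ : ∃ e, l = d (w i) + M + e := ⟨l - d (w i) - M, by omega⟩
      have hpos : (0 : ℚ) < (1 + ε) ^ d (w i) := by positivity
      have he : 1 ≤ (1 + ε) ^ e := one_le_pow₀ hb.le
      rw [pow_add, pow_add]
      rw [pow_succ] at h2
      calc ((w i : ℕ) : ℚ) ≤ (1 + ε) ^ d (w i) * (1 + ε) := h2.le
        _ ≤ (1 + ε) ^ d (w i) * ((1 + ε) ^ M * ε) := mul_le_mul_of_nonneg_left hM.le hpos.le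
        _ ≤ (1 + ε) ^ d (w i) * ((1 + ε) ^ M * ε) * (1 + ε) ^ e :=
          le_mul_of_one_le_right (by positivity) he
        _ = _ := by ring)
  refine ⟨ξ, hξ, fun i hi => ?_, fun i hi => ?_⟩
  · rw [h i (by simp [hi]), if_pos (by simpa using hi)]
  · rw [h i (by simp [hi.le]), if_neg (by simpa using hi.ne)]

end ImagePR

/-! ### Images in which larger entries are less divisible by 2 -/

namespace ImagePR

theorem exists_common_denominator {α : Type*} (s : Finset α) (q : α → ℚ) :
    ∃ N : ℕ, 0 < N ∧ ∀ M : ℕ, N ∣ M → ∀ a ∈ s, ∃ z : ℤ, (M : ℚ) * q a = z := by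
  refine ⟨∏ a ∈ s, (q a).den, Finset.prod_pos fun a _ => (q a).den_pos, fun M hM a ha => ?_⟩
  obtain ⟨c, rfl⟩ := (Finset.dvd_prod_of_mem (fun a => (q a).den) ha).trans hM
  refine ⟨c * (q a).num, ?_⟩
  have := Rat.mul_den_eq_num (q a)
  push_cast
  rw [← this]
  ring

/-- In a sum of `2 ^ (a (L - l)) R ^ l ζ l` with `R` huge, the last nonzero term determines the
size and the divisibility by powers of two. -/
theorem dominant_term {L κ a D R Z : ℕ} {ζ : ℕ → ℤ} (hκ : κ ≤ L) (hD : 0 < D) (hDa : D < 2 ^ a)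
    (hR : Odd R) (hRZ : 4 * (L + 1) * 2 ^ (a * L) * (Z + 1) ≤ R) (hζ : ζ κ = D)
    (hζ0 : ∀ l, κ < l → l ≤ L → ζ l = 0) (hζZ : ∀ l ≤ L, |ζ l| ≤ Z) :
    let W := ∑ l ∈ Finset.range (L + 1), (2 : ℤ) ^ (a * (L - l)) * R ^ l * ζ l
    let H := (2 : ℤ) ^ (a * (L - κ)) * R ^ κ * D
    2 ^ (a * (L - κ)) ∣ W ∧ ¬ 2 ^ (a * (L - κ) + a) ∣ W ∧ 3 * H < 4 * W ∧ 4 * W < 5 * H := by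
  intro W H
  have hRpos : 0 < R := hR.pos
  set rest := ∑ l ∈ Finset.range κ, (2 : ℤ) ^ (a * (L - l)) * R ^ l * ζ l with hrest
  have hW : W = rest + H := by
    have h1 : W = ∑ l ∈ Finset.range (κ + 1), (2 : ℤ) ^ (a * (L - l)) * R ^ l * ζ l := by
      symm
      refine Finset.sum_subset (Finset.range_mono (by omega)) fun l hl hl' => ?_
      rw [Finset.mem_range] at hl hl'
      rw [hζ0 l (by omega) (by omega), mul_zero]
    rw [h1, Finset.sum_range_succ, hζ]
  have hrd : (2 : ℤ) ^ (a * (L - κ) + a) ∣ rest := by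
    refine Finset.dvd_sum fun l hl => ?_
    rw [Finset.mem_range] at hl
    refine Dvd.dvd.mul_right (Dvd.dvd.mul_right (pow_dvd_pow _ ?_) _) _
    calc a * (L - κ) + a = a * (L - κ + 1) := by ring
      _ ≤ a * (L - l) := Nat.mul_le_mul_left _ (by omega)
  have hH1 : (R : ℤ) ^ κ ≤ H := by
    have h1 : (1 : ℤ) ≤ 2 ^ (a * (L - κ)) := one_le_pow₀ (by norm_num)
    have h2 : (0 : ℤ) < (R : ℤ) ^ κ := by positivity
    have h3 : (1 : ℤ) ≤ D := by exact_mod_cast hD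
    calc (R : ℤ) ^ κ = 1 * R ^ κ * 1 := by ring
      _ ≤ 2 ^ (a * (L - κ)) * R ^ κ * D := by gcongr
  have hrH : 4 * |rest| < H := by
    refine lt_of_lt_of_le ?_ hH1
    rcases κ with _ | κ
    · simp [hrest]
    have h1 : |rest| ≤ ∑ l ∈ Finset.range (κ + 1), (2 : ℤ) ^ (a * L) * R ^ κ * Z := by
      refine (Finset.abs_sum_le_sum_abs _ _).trans (Finset.sum_le_sum fun l hl => ?_)
      rw [Finset.mem_range] at hl
      rw [abs_mul, abs_of_nonneg (by positivity : (0 : ℤ) ≤ 2 ^ (a * (L - l)) * R ^ l)]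
      have := hζZ l (by omega)
      have hR1 : (1 : ℤ) ≤ R := by exact_mod_cast hRpos
      gcongr
      · norm_num
      · omega
      · omega
    rw [Finset.sum_const, Finset.card_range, nsmul_eq_mul] at h1
    have hRZ' : 4 * ((L : ℤ) + 1) * 2 ^ (a * L) * (Z + 1) ≤ R := by exact_mod_cast hRZ
    have hRκ : (0 : ℤ) < (R : ℤ) ^ κ := by positivity
    have hκL : (((κ + 1 : ℕ) : ℤ)) ≤ L + 1 := by push_cast; omega
    have hp : (0 : ℤ) < 2 ^ (a * L) := by positivity
    calc 4 * |rest| ≤ 4 * (((κ + 1 : ℕ) : ℤ) * (2 ^ (a * L) * R ^ κ * Z)) := by gcongr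
      _ ≤ 4 * (((L : ℤ) + 1) * (2 ^ (a * L) * R ^ κ * Z)) := by gcongr
      _ = (4 * ((L : ℤ) + 1) * 2 ^ (a * L) * Z) * R ^ κ := by ring
      _ < (4 * ((L : ℤ) + 1) * 2 ^ (a * L) * (Z + 1)) * R ^ κ := by
        refine mul_lt_mul_of_pos_right ?_ hRκ
        refine mul_lt_mul_of_pos_left (by omega) (by positivity)
      _ ≤ R * R ^ κ := by gcongr
      _ = (R : ℤ) ^ (κ + 1) := by ring
  have hrest' := abs_le.1 (le_refl |rest|)
  refine ⟨?_, ?_, by omega, by omega⟩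
  · rw [hW]
    refine dvd_add ((pow_dvd_pow _ (Nat.le_add_right _ _)).trans hrd) ?_
    exact Dvd.intro _ (mul_assoc _ _ _).symm
  · rw [hW, dvd_add_right hrd]
    intro h
    change _ ∣ (2 : ℤ) ^ (a * (L - κ)) * R ^ κ * D at h
    rw [pow_add, mul_assoc ((2 : ℤ) ^ (a * (L - κ)))] at h
    have h1 := (mul_dvd_mul_iff_left (by positivity)).1 h
    have h2 : 2 ^ a ∣ R ^ κ * D := by exact_mod_cast h1
    have h3 : Nat.Coprime (2 ^ a) (R ^ κ) :=
      Nat.Coprime.pow _ _ (Nat.coprime_two_left.2 hR)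
    exact absurd (Nat.le_of_dvd hD (h3.dvd_of_dvd_mul_left h2)) (by omega)

/-- A finite image partition regular matrix has an image in which larger size, up to a factor of
two, goes with lower divisibility by powers of two. -/
theorem IPR.exists_nested_image {ι : Type*} [Fintype ι] {n : ℕ} {B : Matrix ι (Fin n) ℚ}
    (hB : IPR B) : ∃ (x : Fin n → ℕ+) (w : ι → ℕ+), (∀ i, image B x i = ((w i : ℕ) : ℚ)) ∧
      ∀ i i', 2 * (w i : ℕ) ≤ w i' → ∃ e, 2 ^ e ∣ (w i : ℕ) ∧ ¬ 2 ^ e ∣ (w i' : ℕ) := by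
  obtain ⟨k, hk⟩ := hB.exists_grading
  choose ξ' hξ' hξ1' hξ0' using hk
  -- The all-ones vector in degree 0 makes the combined vector positive; the row degrees shift by
  -- one.
  let ξ : ℕ → Fin n → ℚ := fun l => Nat.casesOn l (fun _ => 1) ξ'
  let κ : ι → ℕ := fun i => k i + 1
  have hξ : ∀ l j, 0 ≤ ξ l j := by
    rintro (_ | l) j
    exacts [zero_le_one, hξ' l j]
  have hξ1 : ∀ i, ∑ j, B i j * ξ (κ i) j = 1 := fun i => hξ1' _ i rfl
  have hξ0 : ∀ i l, κ i < l → ∑ j, B i j * ξ l j = 0 := by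
    rintro i (_ | l) hl
    · omega
    · exact hξ0' l i (by simp only [κ] at hl; omega)
  clear_value κ
  obtain ⟨L, hL⟩ : ∃ L, ∀ i, κ i ≤ L :=
    ⟨Finset.univ.sup κ, fun i => Finset.le_sup (Finset.mem_univ i)⟩
  obtain ⟨N₁, hN₁, hN₁'⟩ := exists_common_denominator
    (Finset.range (L + 1) ×ˢ (Finset.univ : Finset (Fin n))) fun lj => ξ lj.1 lj.2
  obtain ⟨N₂, hN₂, hN₂'⟩ := exists_common_denominator
    (Finset.range (L + 1) ×ˢ (Finset.univ : Finset ι)) fun li => ∑ j, B li.2 j * ξ li.1 j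
  set D := N₁ * N₂ with hDdef
  have hD : 0 < D := Nat.mul_pos hN₁ hN₂
  have hDQ : (0 : ℚ) < D := by exact_mod_cast hD
  have hy : ∀ l ≤ L, ∀ j, ∃ y : ℕ, (D : ℚ) * ξ l j = y := by
    intro l hl j
    obtain ⟨z, hz⟩ := hN₁' D (Dvd.intro _ rfl) (l, j) (by simp; omega)
    have hz0 : 0 ≤ z := by
      have : (0 : ℚ) ≤ z := hz ▸ mul_nonneg hDQ.le (hξ l j)
      exact_mod_cast this
    exact ⟨z.toNat, by rw [hz]; exact_mod_cast (Int.toNat_of_nonneg hz0).symm⟩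
  have hζ : ∀ i, ∀ l, ∃ z : ℤ, l ≤ L → (D : ℚ) * ∑ j, B i j * ξ l j = z := by
    intro i l
    by_cases hl : l ≤ L
    · obtain ⟨z, hz⟩ := hN₂' D (Dvd.intro_left _ rfl) (l, i) (by simp; omega)
      exact ⟨z, fun _ => hz⟩
    · exact ⟨0, fun h => (hl h).elim⟩
  choose! y hy using hy
  choose ζ hζ using hζ
  obtain ⟨Z, hZ⟩ : ∃ Z : ℕ, ∀ i, ∀ l ≤ L, |ζ i l| ≤ Z := by
    refine ⟨∑ i, ∑ l ∈ Finset.range (L + 1), (ζ i l).natAbs, fun i l hl => ?_⟩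
    have h1 := Finset.single_le_sum (f := fun l => (ζ i l).natAbs) (fun _ _ => Nat.zero_le _)
      (Finset.mem_range.2 (Nat.lt_succ_of_le hl))
    have h2 := Finset.single_le_sum
      (f := fun i => ∑ l ∈ Finset.range (L + 1), (ζ i l).natAbs) (fun _ _ => Nat.zero_le _)
      (Finset.mem_univ i)
    rw [Int.abs_eq_natAbs]
    exact_mod_cast h1.trans h2
  let R := 2 * (2 * (L + 1) * 2 ^ (D * L) * (Z + 1)) + 1
  have hR : Odd R := ⟨_, rfl⟩
  have hRpos : 0 < R := hR.pos
  have hRZ : 4 * (L + 1) * 2 ^ (D * L) * (Z + 1) ≤ R := by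
    simp only [R]
    nlinarith
  have hdom := fun i => dominant_term (ζ := ζ i) (hL i) hD Nat.lt_two_pow_self hR hRZ
    (by
      have := hζ i (κ i) (hL i)
      rw [hξ1, mul_one] at this
      exact_mod_cast this.symm)
    (fun l hl hlL => by
      have := hζ i l hlL
      rw [hξ0 i l hl, mul_zero] at this
      exact_mod_cast this.symm) (hZ i)
  simp only at hdom
  set W : ι → ℤ := fun i =>
    ∑ l ∈ Finset.range (L + 1), (2 : ℤ) ^ (D * (L - l)) * R ^ l * ζ i l with hWdef
  have hWpos : ∀ i, 0 < W i := by
    intro i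
    have h1 := (hdom i).2.2.1
    have h2 : (0 : ℤ) < 2 ^ (D * (L - κ i)) * R ^ κ i * D := by positivity
    change _ < 4 * W i at h1
    omega
  let X : Fin n → ℕ := fun j => ∑ l ∈ Finset.range (L + 1), 2 ^ (D * (L - l)) * R ^ l * y l j
  have hX : ∀ j, 0 < X j := by
    intro j
    refine Finset.sum_pos' (fun _ _ => Nat.zero_le _) ⟨0, by simp, ?_⟩
    have h0 : (D : ℚ) * 1 = y 0 j := hy 0 (Nat.zero_le _) j
    rw [mul_one] at h0
    have h0' : D = y 0 j := by exact_mod_cast h0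
    rw [← h0']
    positivity
  let X' : Fin n → ℕ+ := fun j => ⟨X j, hX j⟩
  have hX' : ∀ j, (X' j : ℕ) = X j := fun _ => rfl
  have himage : ∀ i, image B X' i = W i := by
    intro i
    rw [image_eq_sum]
    simp only [hX', X, hWdef]
    push_cast
    simp only [Finset.mul_sum]
    rw [Finset.sum_comm]
    refine Finset.sum_congr rfl fun l hl => ?_
    have hl' : l ≤ L := Nat.lt_succ_iff.1 (Finset.mem_range.1 hl)
    rw [← hζ i l hl', Finset.mul_sum, Finset.mul_sum]
    refine Finset.sum_congr rfl fun j _ => ?_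
    rw [← hy l hl' j]
    ring
  have hcast : ∀ i, (((W i).toNat : ℕ) : ℤ) = W i := fun i => Int.toNat_of_nonneg (hWpos i).le
  refine ⟨X', fun i => ⟨(W i).toNat, by have := hWpos i; omega⟩,
    fun i => ?_, fun i i' hii => ?_⟩
  · rw [himage i, PNat.mk_coe]
    exact_mod_cast (hcast i).symm
  · simp only [PNat.mk_coe] at hii ⊢
    have hii' : 2 * W i ≤ W i' := by rw [← hcast i, ← hcast i']; exact_mod_cast hii
    have hd : ∀ e i, (2 ^ e ∣ (W i).toNat) ↔ (2 : ℤ) ^ e ∣ W i := by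
      intro e i
      conv_rhs => rw [← hcast i]
      exact_mod_cast Int.natCast_dvd_natCast.symm
    simp only [hd]
    -- The leading term determines an entry up to a factor between 3/4 and 5/4, and leading terms do
    -- not decrease with the degree. A ratio of 2 thus forces a larger degree.
    have hlt : κ i < κ i' := by
      by_contra! hle
      have h1 := (hdom i).2.2.1
      have h2 := (hdom i').2.2.2
      change _ < 4 * W i at h1
      change 4 * W i' < _ at h2
      have h3 : (2 : ℤ) ^ (D * (L - κ i')) * R ^ κ i' * D ≤ 2 ^ (D * (L - κ i)) * R ^ κ i * D := by
        rcases hle.lt_or_eq with hlt | heq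
        · obtain ⟨e, he⟩ : ∃ e, κ i = κ i' + 1 + e := ⟨κ i - κ i' - 1, by omega⟩
          refine mul_le_mul_of_nonneg_right ?_ (by positivity)
          have h4 : 2 ^ (D * (L - κ i')) ≤ R := by
            refine (Nat.pow_le_pow_right two_pos (Nat.mul_le_mul_left D
              (Nat.sub_le L (κ i')))).trans (le_trans ?_ hRZ)
            have : 0 < 2 ^ (D * L) := by positivity
            nlinarith [Nat.zero_le (2 ^ (D * L) * L * Z), Nat.zero_le (2 ^ (D * L) * L),
              Nat.zero_le (2 ^ (D * L) * Z)]
          have h4' : (2 : ℤ) ^ (D * (L - κ i')) ≤ R := by exact_mod_cast h4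
          have hR1 : (1 : ℤ) ≤ R := by exact_mod_cast hRpos
          calc (2 : ℤ) ^ (D * (L - κ i')) * R ^ κ i' ≤ R * R ^ κ i' := by gcongr
            _ = R ^ (κ i' + 1) := by ring
            _ ≤ R ^ κ i := pow_le_pow_right₀ hR1 (by omega)
            _ ≤ 2 ^ (D * (L - κ i)) * R ^ κ i :=
              le_mul_of_one_le_left (by positivity) (one_le_pow₀ (by norm_num))
        · rw [heq]
      have h4 : (0 : ℤ) < 2 ^ (D * (L - κ i)) * R ^ κ i * D := by positivity
      omega
    refine ⟨D * (L - κ i), (hdom i).1, fun h => (hdom i').2.1 ?_⟩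
    refine (pow_dvd_pow _ ?_).trans h
    calc D * (L - κ i') + D = D * (L - κ i' + 1) := by ring
      _ ≤ D * (L - κ i) := Nat.mul_le_mul_left D (by have := hL i'; omega)

end ImagePR

/-! ### Digits of block sums and the descent -/

namespace ImagePR

/-- `m` is a sum `∑ d t * c t` over a finite nonempty set of indices `t`, with `c t ∈ V t`. -/
def IsBlockSum (d : ℕ → ℕ) (V : ℕ → Set ℕ) (m : ℕ) : Prop :=
  ∃ (F : Finset ℕ) (c : ℕ → ℕ), F.Nonempty ∧ (∀ t ∈ F, c t ∈ V t) ∧ (∀ t ∉ F, c t = 0) ∧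
    m = ∑ t ∈ F, d t * c t

/-- Both lower parts are the remainder of the common total modulo `d τ`. -/
theorem sum_range_eq_of_lt {d a b : ℕ → ℕ} {τ T : ℕ} (hτT : τ ≤ T)
    (hd : ∀ s, τ ≤ s → d τ ∣ d s)
    (h : ∑ s ∈ Finset.range T, d s * a s = ∑ s ∈ Finset.range T, d s * b s)
    (ha : ∑ s ∈ Finset.range τ, d s * a s < d τ) (hb : ∑ s ∈ Finset.range τ, d s * b s < d τ) :
    ∑ s ∈ Finset.range τ, d s * a s = ∑ s ∈ Finset.range τ, d s * b s := by
  have key : ∀ f : ℕ → ℕ, ∑ s ∈ Finset.range τ, d s * f s < d τ →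
      (∑ s ∈ Finset.range T, d s * f s) % d τ = ∑ s ∈ Finset.range τ, d s * f s := by
    intro f hf
    have h1 : d τ ∣ ∑ s ∈ Finset.Ico τ T, d s * f s :=
      Finset.dvd_sum fun s hs => (hd s (Finset.mem_Ico.1 hs).1).mul_right _
    rw [← Finset.sum_range_add_sum_Ico _ hτT, Nat.add_mod, Nat.mod_eq_zero_of_dvd h1, add_zero,
      Nat.mod_mod, Nat.mod_eq_of_lt hf]
  rw [← key a ha, ← key b hb, h]

/-- If the blocks `V t` are nested, they can be scaled so that their block sums contain no solution
of the block system. -/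
theorem exists_scaling_without_solution (V : ℕ → Set ℕ) (M : ℕ → ℕ)
    (hM : ∀ t, ∀ v ∈ V t, v ≤ M t) (hpos : ∀ t, ∀ v ∈ V t, 0 < v)
    (hV : ∀ t, ∀ u ∈ V t, ∀ w ∈ V t, 2 * u ≤ w → ∃ e, 2 ^ e ∣ u ∧ ¬ 2 ^ e ∣ w) :
    ∃ d : ℕ → ℕ, (∀ t, 0 < d t) ∧ ∀ y : ℕ → ℕ, (∀ n, IsBlockSum d V (y n)) →
      ¬ ∀ n, IsBlockSum d V (blockForm y n) := by
  let g : ℕ → ℕ := fun n => 2 ^ (n + 1)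
  have hg : Monotone g := fun a b hab => Nat.pow_le_pow_right two_pos (by omega)
  have hgit : Monotone fun k => g^[k] 0 := hg.monotone_iterate_of_le_map (Nat.zero_le _)
  -- This bounds the coefficient sums of the rows used in digit `t`. The descent makes at most `M t`
  -- steps, and `g` bounds the window reached from a given index.
  let P : ℕ → ℕ := fun t => 2 + 2 ^ (g^[M t] 0)
  have hP : ∀ t, 1 ≤ P t := fun t => (by norm_num : 1 ≤ 2).trans (Nat.le_add_right _ _)
  -- Both `P t` and `P (t + 1)` occur: no carry may enter digit `t + 1`, either when digit `t` is
  -- isolated from above or when digit `t + 1` is isolated from below.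
  let Q : ℕ → ℕ := fun t => 1 + (P t + P (t + 1)) * (1 + M t)
  let d : ℕ → ℕ := fun t => ∏ s ∈ Finset.range t, Q s
  have hd : ∀ t, 0 < d t := fun t => Finset.prod_pos fun s _ => by simp only [Q]; omega
  have hdvd : ∀ τ s, τ ≤ s → d τ ∣ d s := fun τ s hτs =>
    Finset.prod_dvd_prod_of_subset _ _ _ (Finset.range_mono hτs)
  let S : ℕ → ℕ := fun τ => ∑ s ∈ Finset.range τ, d s * M s
  have hstep : ∀ t, P t * S t < d t → (P t + P (t + 1)) * S (t + 1) < d (t + 1) := by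
    intro t ht
    have h1 : S t ≤ P t * S t := Nat.le_mul_of_pos_left _ (hP t)
    have h2 : S (t + 1) ≤ d t * (1 + M t) := by
      have : S (t + 1) = S t + d t * M t := Finset.sum_range_succ _ _
      rw [this, mul_add]
      omega
    have h3 : d (t + 1) = d t * Q t := Finset.prod_range_succ _ _
    calc (P t + P (t + 1)) * S (t + 1) ≤ (P t + P (t + 1)) * (d t * (1 + M t)) :=
          Nat.mul_le_mul_left _ h2
      _ < d t + (P t + P (t + 1)) * (d t * (1 + M t)) := Nat.lt_add_of_pos_left (hd t)
      _ = d (t + 1) := by rw [h3]; simp only [Q]; ring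
  have hS : ∀ t, P t * S t < d t := by
    intro t
    induction t with
    | zero => simpa [S] using hd 0
    | succ t ih =>
      refine lt_of_le_of_lt ?_ (hstep t ih)
      exact Nat.mul_le_mul_right _ (Nat.le_add_left _ _)
  have hS' : ∀ t, P t * S (t + 1) < d (t + 1) := fun t =>
    lt_of_le_of_lt (Nat.mul_le_mul_right _ (Nat.le_add_right _ _)) (hstep t (hS t))
  refine ⟨d, hd, fun y hy hz => ?_⟩
  choose F c hF hcV hc0 hyc using hy
  choose G z hG hzV hz0 hyz using hz
  have hcM : ∀ n t, c n t ≤ M t := by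
    intro n t
    by_cases ht : t ∈ F n
    · exact hM t _ (hcV n t ht)
    · rw [hc0 n t ht]; exact Nat.zero_le _
  have hzM : ∀ n t, z n t ≤ M t := by
    intro n t
    by_cases ht : t ∈ G n
    · exact hM t _ (hzV n t ht)
    · rw [hz0 n t ht]; exact Nat.zero_le _
  have hsum : ∀ (H : Finset ℕ) (f : ℕ → ℕ), (∀ t ∉ H, f t = 0) → ∀ T, H ⊆ Finset.range T →
      ∑ t ∈ H, d t * f t = ∑ t ∈ Finset.range T, d t * f t := fun H f hf T hT =>
    Finset.sum_subset hT fun t _ ht => by rw [hf t ht, mul_zero]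
  let b : ℕ → ℕ → ℕ := fun n t => blockForm (fun i => c i t) n
  have hbM : ∀ t n, n ≤ g^[M t] 0 → ∀ s, b n s ≤ P t * M s := by
    intro t n hn s
    have h1 : ∑ i ∈ Finset.Ico (2 ^ n) (2 ^ (n + 1)), c i s ≤ 2 ^ n * M s := by
      refine (Finset.sum_le_sum fun i _ => hcM i s).trans ?_
      rw [Finset.sum_const, Nat.card_Ico, smul_eq_mul, pow_succ]
      exact Nat.mul_le_mul_right _ (by omega)
    have h2 : 2 ^ n ≤ 2 ^ (g^[M t] 0) := Nat.pow_le_pow_right two_pos hn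
    have h3 := hcM n s
    calc b n s ≤ 2 * M s + 2 ^ n * M s := by
          simp only [b, blockForm]
          omega
      _ = (2 + 2 ^ n) * M s := by ring
      _ ≤ P t * M s := Nat.mul_le_mul_right _ (by simp only [P]; omega)
  -- Without carries the row equation holds digitwise: compare the partial sums below `t` and below
  -- `t + 1`.
  have hrel : ∀ t n, n ≤ g^[M t] 0 → z n t = b n t := by
    intro t n hn
    obtain ⟨T, hT⟩ : ∃ T, t + 1 ≤ T ∧ G n ⊆ Finset.range T ∧ F n ⊆ Finset.range T ∧
        ∀ i ∈ Finset.Ico (2 ^ n) (2 ^ (n + 1)), F i ⊆ Finset.range T := by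
      let U : Finset ℕ := G n ∪ F n ∪ (Finset.Ico (2 ^ n) (2 ^ (n + 1))).biUnion F
      refine ⟨t + 1 + (U.sup id + 1), by omega, ?_⟩
      have hU : U ⊆ Finset.range (t + 1 + (U.sup id + 1)) := fun s hs => by
        have : s ≤ U.sup id := Finset.le_sup (f := id) hs
        rw [Finset.mem_range]
        omega
      refine ⟨fun s hs => hU ?_, fun s hs => hU ?_, fun i hi s hs => hU ?_⟩
      · exact Finset.mem_union_left _ (Finset.mem_union_left _ hs)
      · exact Finset.mem_union_left _ (Finset.mem_union_right _ hs)
      · exact Finset.mem_union_right _ (Finset.mem_biUnion.2 ⟨i, hi, hs⟩)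
    obtain ⟨htT, hGT, hFT, hFiT⟩ := hT
    have heq : ∑ s ∈ Finset.range T, d s * z n s = ∑ s ∈ Finset.range T, d s * b n s := by
      rw [← hsum _ _ (hz0 n) T hGT, ← hyz n]
      have h1 : ∀ s, d s * b n s
          = 2 * (d s * c n s) + ∑ i ∈ Finset.Ico (2 ^ n) (2 ^ (n + 1)), d s * c i s := by
        intro s
        simp only [b, blockForm]
        rw [← Finset.mul_sum]
        ring
      simp only [h1]
      rw [Finset.sum_add_distrib, ← Finset.mul_sum, Finset.sum_comm,
        ← hsum _ _ (hc0 n) T hFT, ← hyc n]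
      unfold blockForm
      congr 1
      refine Finset.sum_congr rfl fun i hi => ?_
      rw [hyc i, hsum _ _ (hc0 i) T (hFiT i hi)]
    have hbound : ∀ τ, P t * S τ < d τ → ∑ s ∈ Finset.range τ, d s * z n s < d τ ∧
        ∑ s ∈ Finset.range τ, d s * b n s < d τ := by
      intro τ hτ
      have : ∀ f : ℕ → ℕ, (∀ s, f s ≤ P t * M s) → ∑ s ∈ Finset.range τ, d s * f s < d τ := by
        intro f hf
        refine lt_of_le_of_lt ?_ hτ
        simp only [S]
        rw [Finset.mul_sum]
        refine Finset.sum_le_sum fun s _ => ?_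
        calc d s * f s ≤ d s * (P t * M s) := Nat.mul_le_mul_left _ (hf s)
          _ = P t * (d s * M s) := by ring
      exact ⟨this _ fun s => (hzM n s).trans (Nat.le_mul_of_pos_left _ (hP t)),
        this _ (hbM t n hn)⟩
    have e1 := sum_range_eq_of_lt (τ := t) (by omega) (hdvd t) heq (hbound t (hS t)).1
      (hbound t (hS t)).2
    have e2 := sum_range_eq_of_lt (τ := t + 1) htT (hdvd (t + 1)) heq (hbound _ (hS' t)).1
      (hbound _ (hS' t)).2
    rw [Finset.sum_range_succ, Finset.sum_range_succ, e1] at e2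
    exact Nat.eq_of_mul_eq_mul_left (hd t) (Nat.add_left_cancel e2)
  obtain ⟨t, ht⟩ := hF 0
  -- If this fails at `e`, nestedness gives a power `2 ^ e'` with `e' < e` dividing `c n t` but not
  -- `z n t`. By induction it divides all digits in the window, hence `z n t`. For `n = 0` and `e =
  -- M t` the digit is too small to be so divisible.
  have descent : ∀ e ≤ M t, ∀ n ≤ g^[M t - e] 0, 2 ^ e ∣ c n t := by
    intro e
    induction e using Nat.strong_induction_on with
    | _ e ih =>
    intro he n hn
    by_contra hndvd
    have hn' : n ≤ g^[M t] 0 := hn.trans (hgit (Nat.sub_le _ _))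
    have hz := hrel t n hn'
    have htF : t ∈ F n := by
      by_contra h
      exact hndvd (by rw [hc0 n t h]; exact dvd_zero _)
    have hcpos := hpos t _ (hcV n t htF)
    have hbz : 2 * c n t ≤ z n t := by
      rw [hz]
      simp only [b, blockForm]
      omega
    have htG : t ∈ G n := by
      by_contra h
      rw [hz0 n t h] at hbz
      omega
    obtain ⟨e', he1, he2⟩ := hV t _ (hcV n t htF) _ (hzV n t htG) hbz
    have hee : e' < e := by
      by_contra! h
      exact hndvd ((pow_dvd_pow 2 h).trans he1)
    refine he2 ?_
    rw [hz]
    refine dvd_add (he1.mul_left 2) (Finset.dvd_sum fun i hi => ih e' hee (by omega) i ?_)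
    have h1 : i ≤ g n := (Finset.mem_Ico.1 hi).2.le
    have h2 : g (g^[M t - e] 0) ≤ g^[M t - e'] 0 := by
      rw [← Function.iterate_succ_apply' g]
      exact hgit (by omega)
    exact h1.trans ((hg hn).trans h2)
  have h0 := hcV 0 t ht
  have h1 := Nat.le_of_dvd (hpos t _ h0) (descent (M t) le_rfl 0 (Nat.zero_le _))
  have h2 := hM t _ h0
  have h3 : M t < 2 ^ M t := Nat.lt_two_pow_self
  omega

/-! ### Images of DH-matrices as block sums -/

/-- The column number of the `t`-th column of the `n`-th block. -/
def blockColumn (B : ℕ → FinMatrix) (a : Σ n, Fin (B n).cols) : ℕ :=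
  blockStart B a.1 + a.2

theorem blockStart_succ (B : ℕ → FinMatrix) (n : ℕ) :
    blockStart B (n + 1) = blockStart B n + (B n).cols :=
  Finset.sum_range_succ _ _

theorem blockStart_mono (B : ℕ → FinMatrix) : Monotone (blockStart B) :=
  monotone_nat_of_le_succ fun n => by rw [blockStart_succ]; exact Nat.le_add_right _ _

theorem le_blockStart (B : ℕ → FinMatrix) (n : ℕ) : n ≤ blockStart B n := by
  induction n with
  | zero => exact Nat.zero_le _
  | succ n ih =>
    rw [blockStart_succ]
    have := (B n).cols.pos
    omega

theorem blockColumn_bijective (B : ℕ → FinMatrix) : Function.Bijective (blockColumn B) := by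
  constructor
  · have hne : ∀ (n n' : ℕ) (t : Fin (B n).cols) (t' : Fin (B n').cols), n < n' →
        blockColumn B ⟨n, t⟩ ≠ blockColumn B ⟨n', t'⟩ := by
      intro n n' t t' h
      have h1 := blockStart_mono B (Nat.succ_le_of_lt h)
      rw [Nat.succ_eq_add_one, blockStart_succ] at h1
      have := t.2
      simp only [blockColumn]
      omega
    rintro ⟨n, t⟩ ⟨n', t'⟩ h
    rcases lt_trichotomy n n' with hlt | rfl | hlt
    · exact (hne _ _ t t' hlt h).elim
    · simp only [blockColumn, Nat.add_left_cancel_iff] at h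
      rw [Fin.ext h]
    · exact (hne _ _ t' t hlt h.symm).elim
  · intro j
    classical
    have hex : ∃ n, j < blockStart B (n + 1) := ⟨j, le_blockStart B (j + 1)⟩
    have h1 := Nat.find_spec hex
    set n := Nat.find hex with hn
    have h2 : blockStart B n ≤ j := by
      rcases hm : n with _ | m
      · simp [blockStart]
      · exact not_lt.1 (Nat.find_min hex (show m < Nat.find hex by omega))
    rw [blockStart_succ] at h1
    exact ⟨⟨n, j - blockStart B n, by omega⟩, Nat.add_sub_cancel' h2⟩

theorem finsum_blockRow {B : ℕ → FinMatrix} {r : ℕ → ℚ} {F : Finset ℕ}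
    {ρ : ∀ n, Fin (B n).rows}
    (hr : ∀ (n : ℕ) (t : Fin (B n).cols),
      r (blockStart B n + t) = if n ∈ F then (B n).mat (ρ n) t else 0)
    (x : ℕ → ℕ+) :
    ∑ᶠ j, r j * ((x j : ℕ) : ℚ) =
      ∑ n ∈ F, image (B n).mat (fun t => x (blockColumn B ⟨n, t⟩)) (ρ n) := by
  let e := Equiv.ofBijective _ (blockColumn_bijective B)
  rw [← finsum_comp_equiv e]
  have h1 : ∀ a : Σ n, Fin (B n).cols, r (e a) * ((x (e a) : ℕ) : ℚ) =
      if a.1 ∈ F then (B a.1).mat (ρ a.1) a.2 * ((x (blockColumn B a) : ℕ) : ℚ) else 0 := by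
    intro a
    change r (blockStart B a.1 + a.2) * _ = _
    rw [hr]
    split_ifs
    · rfl
    · rw [zero_mul]
  rw [finsum_eq_sum_of_support_subset (s := F.sigma fun _ => Finset.univ)]
  · rw [Finset.sum_sigma]
    refine Finset.sum_congr rfl fun n hn => ?_
    rw [image_eq_sum]
    refine Finset.sum_congr rfl fun t _ => ?_
    rw [h1, if_pos hn]
  · intro a ha
    rw [Function.mem_support, h1] at ha
    simp only [Finset.coe_sigma, Set.mem_sigma_iff, Finset.mem_coe, Finset.coe_univ, Set.mem_univ,
      and_true]
    by_contra h
    exact ha (if_neg h)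

/-- Some image of a DH-matrix contains no solution of the block system. -/
theorem IsDHMatrix.exists_image_without_solution {D : Matrix ℕ ℕ ℚ} (hD : IsDHMatrix D) :
    ∃ x : ℕ → ℕ+, ∀ y : ℕ → ℕ, (∀ n, (y n : ℚ) ∈ Set.range (image D x)) →
      ¬ ∀ n, (blockForm y n : ℚ) ∈ Set.range (image D x) := by
  obtain ⟨B, hB, hrows⟩ := hD
  have hIPR : ∀ t, IPR (B t).mat := fun t => by
    have : B t ∈ Set.range B := ⟨t, rfl⟩
    rw [hB] at this
    exact this
  choose ξ w hξw hw using fun t => (hIPR t).exists_nested_image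
  obtain ⟨d, hd, hno⟩ := exists_scaling_without_solution
    (fun t => Set.range fun i => (w t i : ℕ)) (fun t => ∑ i, (w t i : ℕ))
    (by
      rintro t _ ⟨i, rfl⟩
      exact Finset.single_le_sum (f := fun i => (w t i : ℕ)) (fun _ _ => Nat.zero_le _)
        (Finset.mem_univ i))
    (by
      rintro t _ ⟨i, rfl⟩
      exact (w t i).pos)
    (by
      rintro t _ ⟨i, rfl⟩ _ ⟨i', rfl⟩ h
      exact hw t i i' h)
  let e := Equiv.ofBijective _ (blockColumn_bijective B)
  let d' : ℕ → ℕ+ := fun n => ⟨d n, hd n⟩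
  have hd' : ∀ n, (d' n : ℕ) = d n := fun _ => rfl
  -- Scaling the nested image of block `n` by `d n` turns every entry of the image into a block sum.
  let X : (Σ n, Fin (B n).cols) → ℕ+ := fun a => d' a.1 * ξ a.1 a.2
  let x : ℕ → ℕ+ := fun j => X (e.symm j)
  have hx : ∀ n t, x (blockColumn B ⟨n, t⟩) = d' n * ξ n t := fun n t =>
    congrArg X (e.symm_apply_apply ⟨n, t⟩)
  have himage : ∀ m : ℕ, (m : ℚ) ∈ Set.range (image D x) →
      IsBlockSum d (fun t => Set.range fun i => (w t i : ℕ)) m := by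
    rintro m ⟨i, hi⟩
    have hrow : D i ∈ {r | IsBlockRow B r} := hrows ▸ ⟨i, rfl⟩
    obtain ⟨F, ρ, hF, hr⟩ := hrow
    refine ⟨F, fun t => if t ∈ F then (w t (ρ t) : ℕ) else 0, hF, fun t ht => ?_, fun t ht => ?_,
      ?_⟩
    · exact ⟨ρ t, (if_pos ht).symm⟩
    · exact if_neg ht
    · have h1 : image D x i = _ := finsum_blockRow hr x
      rw [hi] at h1
      have h2 : (m : ℚ) = ((∑ t ∈ F, d t * w t (ρ t) : ℕ) : ℚ) := by
        rw [h1]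
        push_cast
        refine Finset.sum_congr rfl fun t _ => ?_
        rw [← hξw t (ρ t), image_eq_sum, image_eq_sum, Finset.mul_sum]
        refine Finset.sum_congr rfl fun j _ => ?_
        rw [hx, PNat.mul_coe, hd']
        push_cast
        ring
      rw [show m = ∑ t ∈ F, d t * w t (ρ t) by exact_mod_cast h2]
      exact Finset.sum_congr rfl fun t ht => congrArg (d t * ·) (if_pos ht).symm
  exact ⟨x, fun y hy hz => hno y (fun n => himage _ (hy n)) fun n => himage _ (hz n)⟩

end ImagePR

/-! ### The matrix and its properties -/

namespace ImagePR

/-- The matrix with rows `x ↦ 2 xₙ + ∑ xᵢ` over `2 ^ n ≤ i < 2 ^ (n + 1)`. -/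
def blockMatrix : Matrix ℕ ℕ ℚ := fun n j =>
  if j = n then 2 else if 2 ^ n ≤ j ∧ j < 2 ^ (n + 1) then 1 else 0

theorem blockMatrix_eq_zero {n j : ℕ} (h : 2 ^ (n + 1) ≤ j) : blockMatrix n j = 0 := by
  have h1 : n + 1 < 2 ^ (n + 1) := Nat.lt_two_pow_self
  unfold blockMatrix
  rw [if_neg (by omega), if_neg (by omega)]

theorem image_one (x : ℕ → ℕ+) (n : ℕ) : image (1 : Matrix ℕ ℕ ℚ) x n = ((x n : ℕ) : ℚ) := by
  unfold image
  rw [finsum_eq_single _ n fun j hj => by rw [Matrix.one_apply_ne' hj, zero_mul],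
    Matrix.one_apply_eq, one_mul]

theorem image_blockMatrix (x : ℕ → ℕ+) (n : ℕ) :
    image blockMatrix x n = (blockForm (fun i => (x i : ℕ)) n : ℚ) := by
  have hn : n < 2 ^ n := Nat.lt_two_pow_self
  have hn' : 2 ^ n ≤ 2 ^ (n + 1) := Nat.pow_le_pow_right two_pos (Nat.le_succ n)
  unfold image
  rw [finsum_eq_sum_of_support_subset (s := Finset.range (2 ^ (n + 1)))]
  · have h : ∀ j, blockMatrix n j * ((x j : ℕ) : ℚ) = (if j = n then 2 * ((x n : ℕ) : ℚ) else 0) +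
        if j ∈ Finset.Ico (2 ^ n) (2 ^ (n + 1)) then ((x j : ℕ) : ℚ) else 0 := by
      intro j
      unfold blockMatrix
      simp only [Finset.mem_Ico]
      by_cases hj : j = n
      · subst hj
        rw [if_pos rfl, if_pos rfl, if_neg (by omega), add_zero]
      · rw [if_neg hj, if_neg hj, zero_add]
        split_ifs <;> simp
    simp only [h]
    rw [Finset.sum_add_distrib, Finset.sum_ite_eq', if_pos (Finset.mem_range.2 (by omega)),
      Finset.sum_ite_mem, Finset.inter_eq_right.2 fun i hi =>
        Finset.mem_range.2 (Finset.mem_Ico.1 hi).2]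
    unfold blockForm
    push_cast
    rfl
  · intro j hj
    rw [Finset.coe_range, Set.mem_Iio]
    by_contra! h
    exact hj (by simp only [blockMatrix_eq_zero h, zero_mul])

theorem image_fromRows_inl {κ : Type*} (A B : Matrix ℕ κ ℚ) (x : κ → ℕ+) (n : ℕ) :
    image (Matrix.fromRows A B) x (Sum.inl n) = image A x n := rfl

theorem image_fromRows_inr {κ : Type*} (A B : Matrix ℕ κ ℚ) (x : κ → ℕ+) (n : ℕ) :
    image (Matrix.fromRows A B) x (Sum.inr n) = image B x n := rfl

theorem rowFinite_fromRows_one_blockMatrix :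
    RowFinite (Matrix.fromRows (1 : Matrix ℕ ℕ ℚ) blockMatrix) := by
  rintro (n | n)
  · refine (Set.finite_singleton n).subset fun j hj => ?_
    by_contra h
    exact hj (Matrix.one_apply_ne' h)
  · refine (Set.finite_Iio (2 ^ (n + 1))).subset fun j hj => ?_
    by_contra! h
    exact hj (blockMatrix_eq_zero (not_lt.1 h))

theorem column_fromRows_one_blockMatrix (j : ℕ) :
    {i | Matrix.fromRows (1 : Matrix ℕ ℕ ℚ) blockMatrix i j ≠ 0}.Finite ∧
      ((∑ᶠ i, Matrix.fromRows (1 : Matrix ℕ ℕ ℚ) blockMatrix i j) = 3 ∨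
        (∑ᶠ i, Matrix.fromRows (1 : Matrix ℕ ℕ ℚ) blockMatrix i j) = 4) := by
  -- A positive `j` lies only in window `Nat.log 2 j`, while 0 lies in none; hence the sum 3 for
  -- column 0 and 4 for the others.
  have hsupp : Function.support (fun i => Matrix.fromRows (1 : Matrix ℕ ℕ ℚ) blockMatrix i j) ⊆
      (({Sum.inl j, Sum.inr j} ∪ if j = 0 then ∅ else {Sum.inr (Nat.log 2 j)} :
        Finset (ℕ ⊕ ℕ)) : Set (ℕ ⊕ ℕ)) := by
    rintro (n | n) hn
    · have : n = j := by
        by_contra h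
        exact hn (Matrix.one_apply_ne h)
      simp [this]
    · by_cases hj : n = j
      · simp [hj]
      · have h : 2 ^ n ≤ j ∧ j < 2 ^ (n + 1) := by
          by_contra h
          refine hn ?_
          change blockMatrix n j = 0
          unfold blockMatrix
          rw [if_neg (Ne.symm hj), if_neg h]
        have h0 : j ≠ 0 := by
          have := Nat.one_le_two_pow (n := n)
          omega
        simp [h0, Nat.log_eq_of_pow_le_of_lt_pow h.1 h.2]
  refine ⟨(Finset.finite_toSet _).subset hsupp, ?_⟩
  rw [finsum_eq_sum_of_support_subset _ hsupp]
  have h1 : Matrix.fromRows (1 : Matrix ℕ ℕ ℚ) blockMatrix (Sum.inl j) j = 1 :=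
    Matrix.one_apply_eq j
  have h2 : Matrix.fromRows (1 : Matrix ℕ ℕ ℚ) blockMatrix (Sum.inr j) j = 2 := if_pos rfl
  by_cases hj : j = 0
  · left
    rw [if_pos hj, Finset.union_empty, Finset.sum_pair Sum.inl_ne_inr, h1, h2]
    norm_num
  · right
    have hlog : Nat.log 2 j < j := Nat.log_lt_self 2 hj
    have h3 : Matrix.fromRows (1 : Matrix ℕ ℕ ℚ) blockMatrix (Sum.inr (Nat.log 2 j)) j = 1 := by
      change blockMatrix (Nat.log 2 j) j = 1
      unfold blockMatrix
      rw [if_neg hlog.ne', if_pos ⟨Nat.pow_log_le_self 2 hj, Nat.lt_pow_succ_log_self one_lt_two j⟩]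
    rw [if_neg hj, Finset.sum_union (by simp [hlog.ne]), Finset.sum_pair Sum.inl_ne_inr,
      Finset.sum_singleton, h1, h2, h3]
    norm_num

theorem stronglyCentrallyIPR_fromRows_one_blockMatrix :
    StronglyCentrallyIPR (Matrix.fromRows (1 : Matrix ℕ ℕ ℚ) blockMatrix) := by
  intro S hS
  obtain ⟨y, hy⟩ := hS.exists_solution
  have hmem : ∀ j, y j ∈ PNat.val '' S := fun j => (hy j).mem j Nat.lt_two_pow_self
  choose x hxS hxy using hmem
  have hxy' : (fun i => (x i : ℕ)) = y := funext hxy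
  have hmono : StrictMono y := strictMono_nat_of_lt_succ fun n =>
    (hy (n + 1)).lt n (n + 1) (Nat.lt_succ_self n) Nat.lt_two_pow_self
  have hform : ∀ n, blockForm y n ∈ PNat.val '' S := fun n =>
    (hy (n + 1)).form_mem n (Nat.lt_succ_self n)
  have hlt : ∀ n j, 2 ^ (n + 1) ≤ j → blockForm y n < y j := fun n j hj =>
    (hy j).form_lt n ((Nat.lt_succ_self n).trans (Nat.lt_two_pow_self.trans_le hj)) j hj
      Nat.lt_two_pow_self
  -- Together with `hlt`, each row value falls strictly between the last variable of its window and
  -- the next variable, so all entries are distinct.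
  have hgt : ∀ n j, j < 2 ^ (n + 1) → y j < blockForm y n := by
    intro n j hj
    have hpos : 0 < y n := by rw [← hxy n]; exact (x n).pos
    have hn : 2 ^ (n + 1) = 2 ^ n + 2 ^ n := by rw [pow_succ]; ring
    have hn1 := Nat.one_le_two_pow (n := n)
    have h1 := Finset.single_le_sum (f := y) (s := Finset.Ico (2 ^ n) (2 ^ (n + 1)))
      (a := 2 ^ (n + 1) - 1) (fun _ _ => Nat.zero_le _) (Finset.mem_Ico.2 (by omega))
    have h2 : y j ≤ y (2 ^ (n + 1) - 1) := hmono.monotone (by omega)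
    unfold blockForm
    omega
  have hformmono : StrictMono (blockForm y) := strictMono_nat_of_lt_succ fun n =>
    (hlt n _ le_rfl).trans (hgt (n + 1) _ (Nat.pow_lt_pow_right one_lt_two (Nat.lt_succ_self _)))
  have hne : ∀ n j, y j ≠ blockForm y n := by
    intro n j
    rcases lt_or_ge j (2 ^ (n + 1)) with h | h
    exacts [(hgt n j h).ne, (hlt n j h).ne']
  have himage : ∀ i, image (Matrix.fromRows (1 : Matrix ℕ ℕ ℚ) blockMatrix) x i =
      ((Sum.elim y (blockForm y) i : ℕ) : ℚ) := by
    rintro (n | n)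
    · rw [image_fromRows_inl, image_one, hxy]; rfl
    · rw [image_fromRows_inr, image_blockMatrix, hxy']; rfl
  have hinj : Function.Injective (Sum.elim y (blockForm y)) :=
    hmono.injective.sumElim hformmono.injective fun j n => hne n j
  refine ⟨x, fun i => ?_, fun i j h => ?_, fun i i' hii h => ?_⟩
  · have : Sum.elim y (blockForm y) i ∈ PNat.val '' S := by
      rcases i with n | n
      exacts [⟨x n, hxS n, hxy n⟩, hform n]
    obtain ⟨m, hm, hmi⟩ := this
    exact ⟨m, hm, by rw [himage i, ← hmi]⟩
  · exact hmono.injective (by rw [← hxy i, ← hxy j, h])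
  · rw [himage, himage] at h
    exact hii (congrArg _ (hinj (by exact_mod_cast h)))

theorem IsDHMatrix.not_imageDominates {D : Matrix ℕ ℕ ℚ} (hD : IsDHMatrix D) :
    ¬ ImageDominates D (Matrix.fromRows (1 : Matrix ℕ ℕ ℚ) blockMatrix) := by
  intro h
  obtain ⟨x, hx⟩ := hD.exists_image_without_solution
  obtain ⟨y, hy⟩ := h x
  refine hx (fun i => y i) (fun n => ?_) fun n => ?_
  · rw [← image_one y n]
    exact hy ⟨Sum.inl n, rfl⟩
  · rw [← image_blockMatrix y n]
    exact hy ⟨Sum.inr n, rfl⟩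

end ImagePR

theorem theorem5p6 :
    ∃ (A : Matrix ℕ ℕ ℚ) (C : Matrix (ℕ ⊕ ℕ) ℕ ℚ),
      C = Matrix.fromRows (1 : Matrix ℕ ℕ ℚ) A ∧
      ImagePR.RowFinite C ∧
      (∀ i j, C i j = 0 ∨ C i j = 1 ∨ C i j = 2) ∧
      (∀ j, {i | C i j ≠ 0}.Finite ∧ ((∑ᶠ i, C i j) = 3 ∨ (∑ᶠ i, C i j) = 4)) ∧
      ImagePR.StronglyCentrallyIPR C ∧
      ∀ D : Matrix ℕ ℕ ℚ, ImagePR.IsDHMatrix D → ¬ ImagePR.ImageDominates D C := by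
  refine ⟨ImagePR.blockMatrix, _, rfl, ImagePR.rowFinite_fromRows_one_blockMatrix, ?_,
    ImagePR.column_fromRows_one_blockMatrix, ImagePR.stronglyCentrallyIPR_fromRows_one_blockMatrix,
    fun D hD => hD.not_imageDominates⟩
  rintro (n | n) j
  · change (1 : Matrix ℕ ℕ ℚ) n j = 0 ∨ (1 : Matrix ℕ ℕ ℚ) n j = 1 ∨ (1 : Matrix ℕ ℕ ℚ) n j = 2
    rw [Matrix.one_apply]
    split_ifs <;> simp
  · change ImagePR.blockMatrix n j = 0 ∨ ImagePR.blockMatrix n j = 1 ∨ ImagePR.blockMatrix n j = 2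
    unfold ImagePR.blockMatrix
    split_ifs <;> simp
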